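/- Let $G$ be a real semisimple Lie group with Lie algebra $\mathfrak g$, and $P\subset G$ a closed parabolic subgroup, with Lie algebra $\mathfrak p$ (so the Killing orthogonal $\mathfrak p^{\perp}$ is the maximal nilpotent ideal of $\mathfrak p$). Let $\mathfrak g_{(0)}=\mathfrak p$, let $\mathfrak g_{(1)}=\mathfrak p^\perp$, $\mathfrak g_{(j+1)}=[\mathfrak g_{(1)},\mathfrak g_{(j)}]$ for $j\ge 1$, and $\mathfrak g_{(j)}=(\mathfrak g_{(1-j)})^\perp$ for $j<0$. Fix a Lie algebra grading $\mathfrak g=\bigoplus_i\mathfrak g^i$ that splits this filtration, i.e. $[\mathfrak g^i,\mathfrak g^j]\subset\mathfrak g^{i+j}$ and $\mathfrak g_{(j)}=\bigoplus_{i\ge j}\mathfrak g^i$. Put $\mathfrak g^{<0}=\bigoplus_{i<0}\mathfrak g^i$, and let $P^0\subset P$ be the subgroup of those $p$ for which $\mathrm{Ad}(p)$ preserves every $\mathfrak g^i$. Let $P^-\subset G$ be a closed subgroup with Lie algebra $\bigoplus_{i\le 0}\mathfrak g^i$ and $P\cap P^-=P^0$. Let $M$ be a connected manifold with a parabolic geometry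 of type $(G,P)$: a principal $P$-bundle $\pi:\mathcal G\to M$ with a Cartan connection $\omega$, i.e. a smooth $\mathfrak g$-valued $1$-form that is $P$-equivariant ($R_p^*\omega=\mathrm{Ad}(p^{-1})\circ\omega$), reproduces the generators of the $P$-action, and is an isomorphism $T_e\mathcal G\to\mathfrak g$ at each $e\in\mathcal G$. Then $TM=\mathcal G\times_P\mathfrak g/\mathfrak p$. Let $I\subset\mathbb R$ be a nonempty open interval and $\gamma:I\to M$ a smooth curve. * $\gamma$ is a *parabolic geodesic* (of general type) if it is the projection of an integral curve $I\to\mathcal G$ of a constant vector field $\omega^{-1}(\xi)$ with $\xi\in\mathcal U=\{\xi\in\mathfrak g\setminus\{0\} : \mathrm{Ad}(p^{-1})\xi\in\mathfrak g^{<0}\text{ for some }p\in P\}$. * A *Weyl structure along $\gamma$* is a smooth reduction $\sigma$ of the $P$-bundle $\gamma^*\mathcal G$ to $P^0$. Its *Weyl connection* is the principal connection whose horizontal space is $\omega^{-1}(\mathfrak g^{<0})$ at the points of the reduction, extended by the right $P$-action; it induces a covariant derivative $\nabla^\sigma$ along $\gamma$ on the associated bundle $TM=\mathcal G\times_P\mathfrak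 g/\mathfrak p$. * A Weyl structure $\sigma$ along $\gamma$ is equivalently the section $s\mapsto[e,[1]]$ ($e$ any point of the reduction over $s$) along $\gamma$ of the bundle of Weyl structures $\mathcal W=\mathcal G\times_P P/P^0$, which embeds in $\mathcal S=\mathcal G\times_P G/P^-$ by $[e,[p]]\mapsto[e,[p]]$. For a smooth $G$-manifold $X$, the tractor connection on $\mathcal G\times_P X$ has as horizontal spaces the images of $\{(\omega_e^{-1}(\xi),-\tfrac{d}{dt}\exp(t\xi)x|_{t=0}):\xi\in\mathfrak g\}\subset T_{(e,x)}(\mathcal G\times X)$. The tractor connection on $\mathcal W$ is induced from the one on $\mathcal S$ (where $X=G/P^-$), and $\sigma$ is *parallel along $\gamma$ in the direction of $\gamma'$* if its section, viewed as a curve in $\mathcal S$, is horizontal. **Theorem.** $\gamma$ is a parabolic geodesic if and only if $\gamma$ is not constant and there is a Weyl structure $\sigma$ along $\gamma$ such that 1. $\gamma$ is a geodesic of the Weyl connection of $\sigma$, i.e. $\nabla^{\sigma}_{\gamma'}\gamma'=0$ on $I$; and 2. $\sigma$, viewed as a section of $\mathcal W$ along $\gamma$, is parallel along $\gamma$ in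 the direction of $\gamma'$ for the tractor connection on $\mathcal W$. -/

import Mathlib

open Set Topology
open scoped Manifold ContDiff

noncomputable section

namespace ParabolicGeometry

/-! ## Lie groups, adjoint action, parabolic subgroups and their gradings -/

section LieGroups

instance : ENat.LEInfty (minSmoothness ℝ 3) where
  out := by
    rw [minSmoothness_of_isRCLikeNormedField]
    exact ENat.LEInfty.out

variable {EG : Type*} [NormedAddCommGroup EG] [NormedSpace ℝ EG]
  {G : Type*} [TopologicalSpace G] [ChartedSpace EG G] [Group G]

/-- The adjoint action of `g` on the Lie algebra: the differential at `1` of `x ↦ g x g⁻¹`. -/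
def Ad (g : G) : GroupLieAlgebra 𝓘(ℝ, EG) G →L[ℝ] GroupLieAlgebra 𝓘(ℝ, EG) G :=
  (mfderiv 𝓘(ℝ, EG) 𝓘(ℝ, EG) (fun x : G => g * x * g⁻¹) 1 :)

/-- The Lie algebra of a closed subgroup `H`: the initial velocities of the one-parameter
subgroups of `G` that lie in `H`. -/
def lieSet (H : Subgroup G) : Set (GroupLieAlgebra 𝓘(ℝ, EG) G) :=
  {ξ | ∃ φ : ℝ → G, ContMDiff 𝓘(ℝ, ℝ) 𝓘(ℝ, EG) ∞ φ ∧ (∀ s t, φ (s + t) = φ s * φ t) ∧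
    (∀ t, φ t ∈ H) ∧ (mfderiv 𝓘(ℝ, ℝ) 𝓘(ℝ, EG) φ 0 (1 : ℝ) : EG) = ξ}

lemma Ad_one : Ad (EG := EG) (1 : G) = ContinuousLinearMap.id ℝ _ := by
  have h : (fun x : G => (1 : G) * x * 1⁻¹) = id := by ext x; simp
  unfold Ad
  rw [h]
  exact mfderiv_id

variable [LieGroup 𝓘(ℝ, EG) ∞ G]

lemma contMDiff_conj (g : G) :
    ContMDiff 𝓘(ℝ, EG) 𝓘(ℝ, EG) ∞ (fun x : G => g * x * g⁻¹) :=
  (contMDiff_const.mul contMDiff_id).mul contMDiff_const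

lemma Ad_mul (g h : G) (ξ : GroupLieAlgebra 𝓘(ℝ, EG) G) :
    Ad (EG := EG) (g * h) ξ = Ad (EG := EG) g (Ad (EG := EG) h ξ) := by
  have e : (fun x : G => (g * h) * x * (g * h)⁻¹)
      = (fun x : G => g * x * g⁻¹) ∘ (fun x : G => h * x * h⁻¹) := by
    ext x; simp [mul_assoc]
  have d : ∀ k x : G, MDifferentiableAt 𝓘(ℝ, EG) 𝓘(ℝ, EG) (fun x : G => k * x * k⁻¹) x :=
    fun k x => (contMDiff_conj k).contMDiffAt.mdifferentiableAt (by simp)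
  have h1 : h * 1 * h⁻¹ = 1 := by simp
  have c := mfderiv_comp (I := 𝓘(ℝ, EG)) (I' := 𝓘(ℝ, EG)) (I'' := 𝓘(ℝ, EG)) (1 : G)
    (d g (h * 1 * h⁻¹)) (d h 1)
  unfold Ad
  rw [e, c, h1]
  rfl

/-- The set of elements of `P` whose adjoint action preserves all the subspaces `gr i`. -/
def levi (P : Subgroup G) (gr : ℤ → Submodule ℝ (GroupLieAlgebra 𝓘(ℝ, EG) G)) : Subgroup G where
  carrier := {p | p ∈ P ∧ ∀ i, ∀ ξ, Ad (EG := EG) p ξ ∈ gr i ↔ ξ ∈ gr i}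
  one_mem' := ⟨P.one_mem, fun i ξ => by rw [Ad_one]; rfl⟩
  mul_mem' := by
    rintro a b ⟨ha, ha'⟩ ⟨hb, hb'⟩
    exact ⟨P.mul_mem ha hb, fun i ξ => by rw [Ad_mul, ha', hb']⟩
  inv_mem' := by
    rintro a ⟨ha, ha'⟩
    refine ⟨P.inv_mem ha, fun i ξ => ?_⟩
    rw [← ha', ← Ad_mul, mul_inv_cancel, Ad_one]
    rfl

variable [CompleteSpace EG]

/-- The orthogonal of a subspace of `𝔤` for the Killing form. -/
def killingOrth (V : Submodule ℝ (GroupLieAlgebra 𝓘(ℝ, EG) G)) :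
    Submodule ℝ (GroupLieAlgebra 𝓘(ℝ, EG) G) :=
  LinearMap.BilinForm.orthogonal (killingForm ℝ (GroupLieAlgebra 𝓘(ℝ, EG) G)) V

/-- A subalgebra `𝔭` of a semisimple Lie algebra is parabolic when its Killing orthogonal
is its nilradical, that is, the greatest nilpotent ideal of `𝔭`. -/
def IsParabolic (𝔭 : LieSubalgebra ℝ (GroupLieAlgebra 𝓘(ℝ, EG) G)) : Prop :=
  ∃ 𝔫 : LieIdeal ℝ 𝔭, IsGreatest {𝔧 : LieIdeal ℝ 𝔭 | LieRing.IsNilpotent 𝔧} 𝔫 ∧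
    (𝔫.toSubmodule).map 𝔭.toSubmodule.subtype = killingOrth 𝔭.toSubmodule

/-- `filtPos 𝔭 n` is the term `𝔤_(n+1)` of the filtration: the descending central series of
`𝔤_(1) = 𝔭^⊥`. -/
def filtPos (𝔭 : LieSubalgebra ℝ (GroupLieAlgebra 𝓘(ℝ, EG) G)) :
    ℕ → Submodule ℝ (GroupLieAlgebra 𝓘(ℝ, EG) G)
  | 0 => killingOrth 𝔭.toSubmodule
  | n + 1 => Submodule.span ℝ
      {ζ | ∃ ξ ∈ killingOrth 𝔭.toSubmodule, ∃ η ∈ filtPos 𝔭 n, ⁅ξ, η⁆ = ζ}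

/-- The filtration `𝔤_(j)`, `j ∈ ℤ`, of `𝔤` induced by `𝔭`: for `j ≥ 1` the descending central
series of `𝔤_(1) = 𝔭^⊥`, then `𝔤_(0) = 𝔭`, and `𝔤_(j) = (𝔤_(1-j))^⊥` for `j < 0`. -/
def filt (𝔭 : LieSubalgebra ℝ (GroupLieAlgebra 𝓘(ℝ, EG) G)) :
    ℤ → Submodule ℝ (GroupLieAlgebra 𝓘(ℝ, EG) G)
  | Int.ofNat 0 => 𝔭.toSubmodule
  | Int.ofNat (n + 1) => filtPos 𝔭 n
  | Int.negSucc n => killingOrth (filtPos 𝔭 (n + 1))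

variable {EP : Type*} [NormedAddCommGroup EP] [NormedSpace ℝ EP]

/-- The algebraic data of a parabolic geometry of type `(G, P)`: `G` is a semisimple Lie group,
`P` a closed subgroup (with its structure of embedded Lie subgroup) whose Lie algebra `𝔭` is
parabolic, `gr` is the chosen splitting of the filtration of `𝔤` into a Lie algebra grading,
`Pm` is a closed subgroup of `G` with Lie algebra `⨁_{i ≤ 0} gr i` and `P ∩ Pm = P⁰`. -/
structure ParabolicType (EG G EP : Type*) [NormedAddCommGroup EG] [NormedSpace ℝ EG] [CompleteSpace EG]
    [TopologicalSpace G] [ChartedSpace EG G] [Group G] [LieGroup 𝓘(ℝ, EG) ∞ G]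
    [NormedAddCommGroup EP] [NormedSpace ℝ EP]
    (P : Subgroup G) [ChartedSpace EP P] where
  semisimple : LieAlgebra.IsSemisimple ℝ (GroupLieAlgebra 𝓘(ℝ, EG) G)
  isClosed : IsClosed (P : Set G)
  embedded : Manifold.IsSmoothEmbedding 𝓘(ℝ, EP) 𝓘(ℝ, EG) ∞ (fun p : P => (p : G))
  /-- the Lie algebra of `P` -/
  𝔭 : LieSubalgebra ℝ (GroupLieAlgebra 𝓘(ℝ, EG) G)
  lie_P : (𝔭 : Set (GroupLieAlgebra 𝓘(ℝ, EG) G)) =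
    range (fun v : GroupLieAlgebra 𝓘(ℝ, EP) P =>
      (mfderiv 𝓘(ℝ, EP) 𝓘(ℝ, EG) (fun p : P => (p : G)) 1 v : EG))
  parabolic : IsParabolic 𝔭
  /-- the grading `𝔤 = ⨁ 𝔤^i` -/
  gr : ℤ → Submodule ℝ (GroupLieAlgebra 𝓘(ℝ, EG) G)
  gr_internal : DirectSum.IsInternal gr
  gr_bracket : ∀ i j, ∀ ξ ∈ gr i, ∀ η ∈ gr j, ⁅ξ, η⁆ ∈ gr (i + j)
  gr_filt : ∀ j, filt 𝔭 j = ⨆ i ≥ j, gr i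
  /-- the opposite subgroup `P⁻` -/
  Pm : Subgroup G
  Pm_closed : IsClosed (Pm : Set G)
  lie_Pm : lieSet (EG := EG) Pm =
    ((⨆ i ≤ (0 : ℤ), gr i : Submodule ℝ (GroupLieAlgebra 𝓘(ℝ, EG) G)) : Set _)
  inf_eq : P ⊓ Pm = levi P gr

namespace ParabolicType

variable {P : Subgroup G} [ChartedSpace EP P] (T : ParabolicType EG G EP P)

/-- The subalgebra `𝔤^{<0}`, as a subspace. -/
def neg : Submodule ℝ (GroupLieAlgebra 𝓘(ℝ, EG) G) := ⨆ i < (0 : ℤ), T.gr i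

/-- The Levi subgroup `P⁰ = {p ∈ P | Ad p preserves the grading}`. -/
def P0 : Subgroup G := levi P T.gr

/-- The set `𝒰` of nonzero `ξ` such that `Ad (p⁻¹) ξ ∈ 𝔤^{<0}` for some `p ∈ P`. -/
def 𝒰 : Set (GroupLieAlgebra 𝓘(ℝ, EG) G) :=
  {ξ | ξ ≠ 0 ∧ ∃ p ∈ P, Ad (EG := EG) p⁻¹ ξ ∈ T.neg}

lemma P0_le_Pm : T.P0 ≤ T.Pm := T.inf_eq.ge.trans inf_le_right

/-- The natural map `P / P⁰ → G / P⁻`. -/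
def leviToOpp : P ⧸ (T.P0.subgroupOf P) → G ⧸ T.Pm :=
  Quotient.map' (fun p : P => (p : G)) fun a b h => by
    rw [QuotientGroup.leftRel_apply] at h ⊢
    exact T.P0_le_Pm h

end ParabolicType

end LieGroups

/-! ## Principal bundles and Cartan connections -/

section Bundles

/-- A tangent vector, as an element of the model vector space: the two types are the same. -/
def toModel {E : Type*} [NormedAddCommGroup E] [NormedSpace ℝ E] {X : Type*}
    [TopologicalSpace X] [ChartedSpace E X] {x : X} (v : TangentSpace 𝓘(ℝ, E) x) : E := v

/-- The velocity of a curve in a manifold. -/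
def velocity {E : Type*} [NormedAddCommGroup E] [NormedSpace ℝ E] {X : Type*}
    [TopologicalSpace X] [ChartedSpace E X] (c : ℝ → X) (s : ℝ) :
    TangentSpace 𝓘(ℝ, E) (c s) :=
  mfderiv 𝓘(ℝ, ℝ) 𝓘(ℝ, E) c s (1 : ℝ)

/-- A smooth (right) principal `P`-bundle with total space `B` over `M`. -/
structure PrincipalBundle (EP P EB B EM M : Type*)
    [NormedAddCommGroup EP] [NormedSpace ℝ EP] [TopologicalSpace P] [ChartedSpace EP P] [Group P]
    [NormedAddCommGroup EB] [NormedSpace ℝ EB] [TopologicalSpace B] [ChartedSpace EB B]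
    [NormedAddCommGroup EM] [NormedSpace ℝ EM] [TopologicalSpace M] [ChartedSpace EM M] where
  /-- the bundle projection -/
  proj : B → M
  /-- the right action -/
  act : B → P → B
  act_one : ∀ e, act e 1 = e
  act_mul : ∀ e p q, act e (p * q) = act (act e p) q
  smooth_proj : ContMDiff 𝓘(ℝ, EB) 𝓘(ℝ, EM) ∞ proj
  smooth_act : ContMDiff (𝓘(ℝ, EB).prod 𝓘(ℝ, EP)) 𝓘(ℝ, EB) ∞ (fun x : B × P => act x.1 x.2)
  proj_act : ∀ e p, proj (act e p) = proj e
  /-- equivariant smooth local trivializations -/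
  locally_trivial : ∀ x : M, ∃ U : Set M, IsOpen U ∧ x ∈ U ∧
    ∃ Φ : OpenPartialHomeomorph B (M × P),
      Φ.source = proj ⁻¹' U ∧ Φ.target = U ×ˢ univ ∧
      ContMDiffOn 𝓘(ℝ, EB) (𝓘(ℝ, EM).prod 𝓘(ℝ, EP)) ∞ Φ Φ.source ∧
      ContMDiffOn (𝓘(ℝ, EM).prod 𝓘(ℝ, EP)) 𝓘(ℝ, EB) ∞ Φ.symm Φ.target ∧
      (∀ e ∈ Φ.source, (Φ e).1 = proj e) ∧
      (∀ e ∈ Φ.source, ∀ p, (Φ (act e p)).2 = (Φ e).2 * p)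

variable {EG : Type*} [NormedAddCommGroup EG] [NormedSpace ℝ EG] [CompleteSpace EG]
  {G : Type*} [TopologicalSpace G] [ChartedSpace EG G] [Group G] [LieGroup 𝓘(ℝ, EG) ∞ G]
  {EP : Type*} [NormedAddCommGroup EP] [NormedSpace ℝ EP]
  {P : Subgroup G} [ChartedSpace EP P]
  {EB : Type*} [NormedAddCommGroup EB] [NormedSpace ℝ EB]
  {B : Type*} [TopologicalSpace B] [ChartedSpace EB B] [IsManifold 𝓘(ℝ, EB) ∞ B]
  {EM : Type*} [NormedAddCommGroup EM] [NormedSpace ℝ EM]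
  {M : Type*} [TopologicalSpace M] [ChartedSpace EM M]

/-- A Cartan geometry of type `(G, P)` on `M`: a principal `P`-bundle `B → M` with a Cartan
connection `ω` (the field `conn`). When `P` is a parabolic subgroup of a semisimple group this is a parabolic
geometry. -/
structure CartanGeometry (EG EP EB B EM M : Type*) {G : Type*}
    [NormedAddCommGroup EG] [NormedSpace ℝ EG] [TopologicalSpace G] [ChartedSpace EG G] [Group G]
    (P : Subgroup G)
    [NormedAddCommGroup EP] [NormedSpace ℝ EP] [ChartedSpace EP P]
    [NormedAddCommGroup EB] [NormedSpace ℝ EB] [TopologicalSpace B] [ChartedSpace EB B]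
    [IsManifold 𝓘(ℝ, EB) ∞ B]
    [NormedAddCommGroup EM] [NormedSpace ℝ EM] [TopologicalSpace M] [ChartedSpace EM M]
    extends PrincipalBundle EP P EB B EM M where
  /-- the Cartan connection, an isomorphism on every tangent space -/
  conn : ∀ e : B, TangentSpace 𝓘(ℝ, EB) e ≃L[ℝ] GroupLieAlgebra 𝓘(ℝ, EG) G
  smooth_conn : ContMDiff 𝓘(ℝ, EB).tangent 𝓘(ℝ, EG) ∞
    (fun v : TangentBundle 𝓘(ℝ, EB) B => toModel (conn v.proj v.snd))
  equivariant : ∀ (e : B) (p : P) (v : TangentSpace 𝓘(ℝ, EB) e),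
    conn (act e p) (mfderiv 𝓘(ℝ, EB) 𝓘(ℝ, EB) (fun e' => act e' p) e v) =
      Ad (EG := EG) (p : G)⁻¹ (conn e v)
  vertical : ∀ (e : B) (ξ : GroupLieAlgebra 𝓘(ℝ, EP) P),
    conn (act e 1) (mfderiv 𝓘(ℝ, EP) 𝓘(ℝ, EB) (fun p : P => act e p) 1 ξ) =
      (mfderiv 𝓘(ℝ, EP) 𝓘(ℝ, EG) (fun p : P => (p : G)) 1 ξ : EG)

namespace CartanGeometry

variable (C : CartanGeometry EG EP EB B EM M P)

/-- The constant vector field `ω⁻¹(ξ)`. -/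
def constField (ξ : GroupLieAlgebra 𝓘(ℝ, EG) G) (e : B) : TangentSpace 𝓘(ℝ, EB) e :=
  (C.conn e).symm ξ

/-- The tangent vector `π_* (ω_e⁻¹ ξ)` of `M`; it represents `[e, ξ + 𝔭]` under the identification
`TM = B ×_P 𝔤/𝔭`. -/
def toTangent (e : B) (ξ : GroupLieAlgebra 𝓘(ℝ, EG) G) : TangentSpace 𝓘(ℝ, EM) (C.proj e) :=
  mfderiv 𝓘(ℝ, EB) 𝓘(ℝ, EM) C.proj e (C.constField ξ e)

/-- `γ`, defined on the open interval `I`, is a parabolic geodesic: the projection of an integral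
curve of a constant vector field `ω⁻¹(ξ)` with `ξ ∈ 𝒰`. -/
def IsParabolicGeodesic (T : ParabolicType EG G EP P) (γ : ℝ → M) (I : Set ℝ) : Prop :=
  ∃ ξ ∈ T.𝒰, ∃ c : ℝ → B, IsMIntegralCurveOn c (C.constField ξ) I ∧
    ∀ s ∈ I, C.proj (c s) = γ s

/-! ### Associated bundles and the tractor connection -/

/-- The equivalence relation `(e, x) ∼ (e p, p⁻¹ x)` on `B × X`. -/
def assocSetoid (X : Type*) [MulAction P X] : Setoid (B × X) where
  r a b := ∃ p : P, b = (C.act a.1 p, p⁻¹ • a.2)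
  iseqv :=
    { refl := fun a => ⟨1, by simp [C.act_one]⟩
      symm := by
        rintro a b ⟨p, rfl⟩
        exact ⟨p⁻¹, by simp [← C.act_mul, C.act_one]⟩
      trans := by
        rintro a b c ⟨p, rfl⟩ ⟨q, rfl⟩
        exact ⟨p * q, by simp [C.act_mul, mul_smul]⟩ }

/-- The associated bundle `B ×_P X`. -/
def Assoc (X : Type*) [MulAction P X] : Type _ := Quotient (C.assocSetoid X)

/-- The class `[e, x]` in `B ×_P X`. -/
def cls {X : Type*} [MulAction P X] (e : B) (x : X) : C.Assoc X :=
  Quotient.mk (C.assocSetoid X) (e, x)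

section Tractor

variable (EX : Type*) [NormedAddCommGroup EX] [NormedSpace ℝ EX]
  {X : Type*} [TopologicalSpace X] [ChartedSpace EX X] [MulAction G X]

/-- The tangent vector `d/dt (exp (tξ) x)` at `t = 0` to a `G`-manifold `X` at `x`. -/
def fundamental (ξ : GroupLieAlgebra 𝓘(ℝ, EG) G) (x : X) : TangentSpace 𝓘(ℝ, EX) x :=
  (mfderiv 𝓘(ℝ, EG) 𝓘(ℝ, EX) (fun g : G => g • x) 1 ξ : EX)

/-- The space `T^H(B × X) = {(ω_e⁻¹ ξ, -ξ̆_x) | ξ ∈ 𝔤}` at `(e, x)`. It contains the kernel of the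
differential of `B × X → B ×_P X`, and its projection is the horizontal space of the tractor
connection of `B ×_P X`. -/
def horizontal (e : B) (x : X) : Set (TangentSpace 𝓘(ℝ, EB) e × TangentSpace 𝓘(ℝ, EX) x) :=
  range fun ξ : GroupLieAlgebra 𝓘(ℝ, EG) G => (C.constField ξ e, -fundamental EX ξ x)

/-- A curve `τ` in `B ×_P X`, defined on the open interval `I`, is smooth and horizontal for the
tractor connection: it lifts locally to smooth curves in `B × X` whose velocity is in
`T^H(B × X)`. -/
def IsTractorParallel {I : Set ℝ} (τ : I → C.Assoc X) : Prop :=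
  ∀ s ∈ I, ∃ U : Set ℝ, IsOpen U ∧ s ∈ U ∧ U ⊆ I ∧ ∃ (c : ℝ → B) (x : ℝ → X),
    ContMDiffOn 𝓘(ℝ, ℝ) 𝓘(ℝ, EB) ∞ c U ∧ ContMDiffOn 𝓘(ℝ, ℝ) 𝓘(ℝ, EX) ∞ x U ∧
    (∀ t : I, (t : ℝ) ∈ U → τ t = C.cls (c t) (x t)) ∧
    ∀ t ∈ U, (velocity c t, velocity x t) ∈ C.horizontal EX (c t) (x t)

end Tractor

/-! ### Weyl structures -/

variable (T : ParabolicType EG G EP P)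

/-- The bundle of Weyl structures `𝒲 = B ×_P P/P⁰`. -/
abbrev WeylBundle : Type _ := C.Assoc (P ⧸ (T.P0.subgroupOf P))

/-- The Moebius bundle `𝒮 = B ×_P G/P⁻`. -/
abbrev MoebiusBundle : Type _ := C.Assoc (G ⧸ T.Pm)

/-- The natural embedding `𝒲 → 𝒮`, `[e, [p]] ↦ [e, [p]]`. -/
def weylToMoebius : C.WeylBundle T → C.MoebiusBundle T :=
  Quotient.map' (s₁ := C.assocSetoid _) (s₂ := C.assocSetoid _)
    (fun a => (a.1, T.leviToOpp a.2)) <| by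
      rintro ⟨e, x⟩ _ ⟨p, rfl⟩
      refine ⟨p, ?_⟩
      induction x using Quotient.inductionOn'
      rfl

/-- A Weyl structure along the curve `γ`, defined on the open interval `I`: a (smooth) reduction to
`P⁰` of the pull-back bundle `γ^* B`. The fibre at `s ∈ I` is `carrier s`. -/
structure WeylAlong (γ : ℝ → M) (I : Set ℝ) where
  /-- the fibres of the reduction -/
  carrier : ℝ → Set B
  proj_eq : ∀ s ∈ I, ∀ e ∈ carrier s, C.proj e = γ s
  orbit : ∀ s ∈ I, ∀ e ∈ carrier s, ∀ e', e' ∈ carrier s ↔ ∃ p : P, (p : G) ∈ T.P0 ∧ e' = C.act e p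
  smooth : ∀ s ∈ I, ∃ U : Set ℝ, IsOpen U ∧ s ∈ U ∧ U ⊆ I ∧ ∃ c : ℝ → B,
    ContMDiffOn 𝓘(ℝ, ℝ) 𝓘(ℝ, EB) ∞ c U ∧ ∀ t ∈ U, c t ∈ carrier t

namespace WeylAlong

variable {C T} {γ : ℝ → M} {I : Set ℝ} (σ : WeylAlong C T γ I)

lemma nonempty (s : I) : (σ.carrier s).Nonempty := by
  obtain ⟨U, -, hs, -, c, -, hc⟩ := σ.smooth s s.2
  exact ⟨c s, hc s hs⟩

/-- The section of `𝒲` along `γ` that corresponds to a Weyl structure: its value at `s` is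
`[e, [1]]`, for any `e` in the fibre of the reduction at `s`. -/
def toSection (s : I) : C.WeylBundle T := C.cls (σ.nonempty s).some ((1 : P) : P ⧸ _)

lemma toSection_eq (s : I) {e : B} (he : e ∈ σ.carrier s) :
    σ.toSection s = C.cls e ((1 : P) : P ⧸ (T.P0.subgroupOf P)) := by
  obtain ⟨p, hp, h⟩ := (σ.orbit s s.2 _ (σ.nonempty s).some_mem e).1 he
  refine Quotient.sound (s := C.assocSetoid _) ⟨p, ?_⟩
  refine Prod.ext h ?_
  change ((1 : P) : P ⧸ (T.P0.subgroupOf P)) = ((p⁻¹ * 1 : P) : P ⧸ (T.P0.subgroupOf P))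
  rw [QuotientGroup.eq]
  simpa [Subgroup.mem_subgroupOf] using hp

/-- The Weyl structure, viewed as a section of `𝒲 ⊆ 𝒮` along `γ`, is parallel along `γ` (in the
direction of `γ'`) for the tractor connection. -/
def IsParallel (EX : Type*) [NormedAddCommGroup EX] [NormedSpace ℝ EX]
    [ChartedSpace EX (G ⧸ T.Pm)] : Prop :=
  C.IsTractorParallel EX fun s : I => C.weylToMoebius T (σ.toSection s)

/-- The horizontal space at `e` (in the fibre over `γ s`) of the Weyl connection: it is
`ω⁻¹(𝔤^{<0})` at the points of the reduction, and is extended by the right action of `P`. -/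
def weylHorizontal (s : ℝ) (e : B) : Set (TangentSpace 𝓘(ℝ, EB) e) :=
  {v | ∃ r ∈ σ.carrier s, ∃ p : P, C.act r p = e ∧ ∃ ξ ∈ T.neg,
    (v : EB) = mfderiv 𝓘(ℝ, EB) 𝓘(ℝ, EB) (fun e' => C.act e' p) r (C.constField ξ r)}

/-- `η ∈ 𝔭` is the value on `v ∈ T_e B` of the connection form of the Weyl connection: the vertical
part of `v` is the fundamental vector `ω_e⁻¹(η)`. -/
def IsWeylForm (s : ℝ) (e : B) (v : TangentSpace 𝓘(ℝ, EB) e)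
    (η : GroupLieAlgebra 𝓘(ℝ, EG) G) : Prop :=
  η ∈ T.𝔭 ∧ v - C.constField η e ∈ σ.weylHorizontal s e

/-- `Z` is the covariant derivative at `s ∈ I`, for the Weyl connection on `TM = B ×_P 𝔤/𝔭`, of the
vector field `Y` along `γ`: if `Y = [c, f + 𝔭]` near `s`, where `c` is a smooth lift of `γ` to `B`
and `f` a smooth function with values in `𝔤`, then `Z = [c, f' + [θ(c'), f] + 𝔭]` where `θ` is the
connection form. -/
def HasWeylDeriv (Y : ∀ t : ℝ, TangentSpace 𝓘(ℝ, EM) (γ t)) (s : ℝ)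
    (Z : TangentSpace 𝓘(ℝ, EM) (γ s)) : Prop :=
  ∃ U : Set ℝ, IsOpen U ∧ s ∈ U ∧ U ⊆ I ∧ ∃ (c : ℝ → B) (f : ℝ → GroupLieAlgebra 𝓘(ℝ, EG) G),
    ContMDiffOn 𝓘(ℝ, ℝ) 𝓘(ℝ, EB) ∞ c U ∧ ContDiffOn ℝ ∞ (fun t => toModel (f t)) U ∧
    (∀ t ∈ U, C.proj (c t) = γ t) ∧
    (∀ t ∈ U, (Y t : EM) = C.toTangent (c t) (f t)) ∧
    ∃ η, σ.IsWeylForm s (c s) (velocity c s) η ∧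
      (Z : EM) = C.toTangent (c s) (deriv f s + ⁅η, f s⁆)

/-- `γ` is a geodesic of the Weyl connection: `∇_{γ'} γ' = 0` on `I`. -/
def IsGeodesic : Prop := ∀ s ∈ I, σ.HasWeylDeriv (fun t => velocity γ t) s 0

end WeylAlong

end CartanGeometry

end Bundles

end ParabolicGeometry

end

/-!
A parabolic geodesic is the projection of an integral curve `c` of a constant vector field
`ω⁻¹(ξ)`; after translating `c` by an element of `P` one may take `ξ ∈ 𝔤^{<0}`, and `ξ ≠ 0`
(`isParabolicGeodesic_iff`). The theorem identifies such curves `c` with the horizontal sections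
of a Weyl structure for which both conditions hold.

Given `c`, its `P⁰`-orbits form a Weyl structure. The curve `c` is horizontal for its Weyl
connection, and along `c` the velocity of `γ` has the constant coordinates `ξ`, so `γ` is a geodesic
(`isGeodesic_weylOfLift`). The section of `𝒢 ×_P G / P⁻` is represented by `c` and the base point
`o` of `G / P⁻`, whose isotropy algebra `⨁_{i ≤ 0} 𝔤^i` contains `ξ`, so it is horizontal
(`isParallel_weylOfLift`). Since `ξ ∉ 𝔭`, the curve `γ` has nonzero velocity.

Conversely, let `σ` be parallel. Comparing a local section `r` of the reduction with the horizontal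
representatives of its section of `𝒢 ×_P G / P⁻` gives `ω(r') ∈ Lie P⁻` (`fund_form_eq_zero`). The
component `w` of `ω(r')` in `𝔭` is then also in `Lie P⁻`, so the solution `a` in `P` of `a' = a w`
stays in `P ∩ P⁻ = P⁰`: the curve `a · o` has vanishing velocity. Therefore `r · a⁻¹` is again a
section of the reduction, and now it is horizontal (`exists_horizontal_section`). Along a horizontal
section the geodesic equation says that the coordinates of `γ'` in `𝔤 / 𝔭 = 𝔤^{<0}` are constant
(`hasDerivAt_form_zero`), that is, the section is an integral curve of a constant vector field. If
one of two such curves is translated by an element of `P⁰` so that they meet, then they have the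
same generator, as `γ'` determines it modulo `𝔭`; so these curves can be continued along the
interval (`exists_integralCurve_of_local`, `WeylAlong.exists_global_integral_section`). The generator is not zero since `γ` is not constant.

The facts on Lie groups needed on the way are: the derivative of `Ad` is the Lie bracket
(`hasDerivAt_adE_apply`), one-parameter subgroups and the equation `a' = a w(t)`
(`exists_oneParameterSubgroup`, `exists_hasVel_leftField`), and that the Lie algebra of `H` is the
isotropy algebra of the base point of `G / H` (`fund_coset_one_eq_zero_iff`). Tangent vectors are
mostly handled as elements of the model vector spaces, through `mder` and `HasVel`.
-/

noncomputable section

set_option linter.unusedSectionVars false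

namespace ParabolicGeometry

/-! ### Velocities of curves -/

section Velocity

variable {E : Type*} [NormedAddCommGroup E] [NormedSpace ℝ E]
  {X : Type*} [TopologicalSpace X] [ChartedSpace E X]
  {F : Type*} [NormedAddCommGroup F] [NormedSpace ℝ F]
  {Y : Type*} [TopologicalSpace Y] [ChartedSpace F Y]
  {F' : Type*} [NormedAddCommGroup F'] [NormedSpace ℝ F']
  {Z : Type*} [TopologicalSpace Z] [ChartedSpace F' Z]

variable (E F) in
/-- The differential of `f` at `x`, as a map between the model vector spaces. -/
def mder (f : X → Y) (x : X) : E →L[ℝ] F := mfderiv 𝓘(ℝ, E) 𝓘(ℝ, F) f x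

variable (E F) in
/-- Differentiability of a map between manifolds modelled on normed spaces. -/
abbrev MDAt (f : X → Y) (x : X) : Prop := MDifferentiableAt 𝓘(ℝ, E) 𝓘(ℝ, F) f x

/-- The curve `c` is differentiable at `s`, with velocity `v`, a vector of the model space. -/
def HasVel (c : ℝ → X) (s : ℝ) (v : E) : Prop :=
  MDAt ℝ E c s ∧ mder ℝ E c s 1 = v

lemma mder_comp {f : X → Y} {g : Y → Z} {x : X} (hg : MDAt F F' g (f x)) (hf : MDAt E F f x)
    (v : E) : mder E F' (fun x => g (f x)) x v = mder F F' g (f x) (mder E F f x v) := by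
  have := mfderiv_comp x hg hf
  unfold mder
  exact congrArg (fun L : E →L[ℝ] F' => L v) this

lemma mder_id (x : X) (v : E) : mder E E (fun x : X => x) x v = v := by
  have := mfderiv_id (I := 𝓘(ℝ, E)) (x := x)
  unfold mder
  exact congrArg (fun L : E →L[ℝ] E => L v) this

lemma mder_const (x : X) (y : Y) (v : E) : mder E F (fun _ : X => y) x v = 0 := by
  have := mfderiv_const (I := 𝓘(ℝ, E)) (I' := 𝓘(ℝ, F)) (x := x) (c := y)
  unfold mder
  exact congrArg (fun L : E →L[ℝ] F => L v) this

lemma mder_congr {f g : X → Y} {x : X} (h : f =ᶠ[𝓝 x] g) : mder E F f x = mder E F g x :=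
  h.mfderiv_eq

lemma mder_eq_fderiv (f : E → F) (x : E) : mder E F f x = fderiv ℝ f x :=
  mfderiv_eq_fderiv

lemma MDAt.comp {f : X → Y} {g : Y → Z} {x : X} (hg : MDAt F F' g (f x)) (hf : MDAt E F f x) :
    MDAt E F' (fun x => g (f x)) x :=
  MDifferentiableAt.comp x hg hf

lemma HasVel.continuousAt {c : ℝ → X} {s : ℝ} {v : E} (h : HasVel c s v) : ContinuousAt c s :=
  h.1.continuousAt

lemma HasVel.velocity_eq {c : ℝ → X} {s : ℝ} {v : E} (h : HasVel c s v) :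
    toModel (velocity (E := E) c s) = v := h.2

lemma MDAt.hasVel {c : ℝ → X} {s : ℝ} (h : MDAt ℝ E c s) :
    HasVel c s (toModel (velocity (E := E) c s)) := ⟨h, rfl⟩

lemma HasVel.unique {c : ℝ → X} {s : ℝ} {v w : E} (h : HasVel c s v) (h' : HasVel c s w) :
    v = w := h.2.symm.trans h'.2

lemma HasVel.congr {c d : ℝ → X} {s : ℝ} {v : E} (h : HasVel c s v) (hd : d =ᶠ[𝓝 s] c) :
    HasVel d s v :=
  ⟨h.1.congr_of_eventuallyEq hd, by rw [mder_congr hd]; exact h.2⟩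

lemma hasVel_const (x : X) (s : ℝ) : HasVel (fun _ => x) s (0 : E) :=
  ⟨mdifferentiableAt_const, mder_const _ _ _⟩

lemma HasVel.comp {c : ℝ → X} {s : ℝ} {v : E} {f : X → Y} (hf : MDAt E F f (c s))
    (h : HasVel c s v) : HasVel (fun t => f (c t)) s (mder E F f (c s) v) :=
  ⟨MDAt.comp hf h.1, by rw [mder_comp hf h.1, h.2]⟩

lemma hasVel_iff_hasDerivAt {c : ℝ → E} {s : ℝ} {v : E} : HasVel c s v ↔ HasDerivAt c v s := by
  unfold HasVel
  rw [MDAt, mdifferentiableAt_iff_differentiableAt, mder_eq_fderiv]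
  constructor
  · rintro ⟨h, rfl⟩
    exact h.hasDerivAt
  · intro h
    exact ⟨h.differentiableAt, h.deriv⟩

lemma hasMFDerivAt_iff_hasVel {c : ℝ → X} {s : ℝ} (v : TangentSpace 𝓘(ℝ, E) (c s)) :
    HasMFDerivAt 𝓘(ℝ, ℝ) 𝓘(ℝ, E) c s ((1 : ℝ →L[ℝ] ℝ).smulRight v) ↔
      HasVel c s (toModel v) := by
  have key : ((1 : ℝ →L[ℝ] ℝ).smulRight (toModel v)) 1 = toModel v := by simp
  constructor
  · intro h
    refine ⟨h.mdifferentiableAt, ?_⟩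
    have := h.mfderiv
    refine (congrArg (fun L : ℝ →L[ℝ] E => L 1) this).trans key
  · rintro ⟨h, h'⟩
    have := h.hasMFDerivAt
    have e : ((1 : ℝ →L[ℝ] ℝ).smulRight (toModel v)) = mder ℝ E c s :=
      ContinuousLinearMap.ext_ring (key.trans h'.symm)
    exact (congrArg (fun L : ℝ →L[ℝ] E => HasMFDerivAt 𝓘(ℝ, ℝ) 𝓘(ℝ, E) c s L) e).mpr this

/-- The chain rule for a map of two variables, in terms of its partial differentials. -/
lemma mder_comp₂ {E₀ W : Type*} [NormedAddCommGroup E₀] [NormedSpace ℝ E₀] [TopologicalSpace W]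
    [ChartedSpace E₀ W] {c : W → X} {d : W → Y} {s : W} {f : X → Y → Z}
    (hf : MDifferentiableAt (𝓘(ℝ, E).prod 𝓘(ℝ, F)) 𝓘(ℝ, F') (fun a : X × Y => f a.1 a.2)
      (c s, d s)) (hc : MDAt E₀ E c s) (hd : MDAt E₀ F d s) (u : E₀) :
    mder E₀ F' (fun t => f (c t) (d t)) s u =
      mder E F' (fun x => f x (d s)) (c s) (mder E₀ E c s u) +
        mder F F' (fun y => f (c s) y) (d s) (mder E₀ F d s u) := by
  have hp : MDifferentiableAt 𝓘(ℝ, E₀) (𝓘(ℝ, E).prod 𝓘(ℝ, F)) (fun t => (c t, d t)) s :=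
    hc.prodMk hd
  have e1 := mfderiv_comp s hf hp
  have e2 := mfderiv_prod_eq_add_apply (v := ((mder E₀ E c s u, mder E₀ F d s u) : E × F)) hf
  have e3 : mfderiv 𝓘(ℝ, E₀) (𝓘(ℝ, E).prod 𝓘(ℝ, F)) (fun t => (c t, d t)) s
      = (mfderiv 𝓘(ℝ, E₀) 𝓘(ℝ, E) c s).prod (mfderiv 𝓘(ℝ, E₀) 𝓘(ℝ, F) d s) :=
    mfderiv_prodMk hc hd
  refine Eq.trans ?_ e2
  refine (congrArg (fun L : E₀ →L[ℝ] F' => L u) e1).trans ?_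
  exact congrArg (fun L : E₀ →L[ℝ] E × F => (mfderiv (𝓘(ℝ, E).prod 𝓘(ℝ, F)) 𝓘(ℝ, F')
    (fun a : X × Y => f a.1 a.2) (c s, d s) : E × F →L[ℝ] F') (L u)) e3

lemma MDAt.comp₂ {E₀ W : Type*} [NormedAddCommGroup E₀] [NormedSpace ℝ E₀] [TopologicalSpace W]
    [ChartedSpace E₀ W] {c : W → X} {d : W → Y} {s : W} {f : X → Y → Z}
    (hf : MDifferentiableAt (𝓘(ℝ, E).prod 𝓘(ℝ, F)) 𝓘(ℝ, F') (fun a : X × Y => f a.1 a.2)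
      (c s, d s)) (hc : MDAt E₀ E c s) (hd : MDAt E₀ F d s) :
    MDAt E₀ F' (fun t => f (c t) (d t)) s :=
  MDifferentiableAt.comp s hf (MDifferentiableAt.prodMk hc hd)

lemma HasVel.comp₂ {c : ℝ → X} {d : ℝ → Y} {s : ℝ} {v : E} {w : F} {f : X → Y → Z}
    (hf : MDifferentiableAt (𝓘(ℝ, E).prod 𝓘(ℝ, F)) 𝓘(ℝ, F') (fun a : X × Y => f a.1 a.2)
      (c s, d s))
    (h : HasVel c s v) (h' : HasVel d s w) :
    HasVel (fun t => f (c t) (d t)) s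
      (mder E F' (fun x => f x (d s)) (c s) v + mder F F' (fun y => f (c s) y) (d s) w) :=
  ⟨MDAt.comp₂ hf h.1 h'.1, by rw [mder_comp₂ hf h.1 h'.1, h.2, h'.2]⟩

/-- A curve whose velocity vanishes near `s` is constant near `s`. -/
lemma eventually_eq_of_hasVel_zero [IsManifold 𝓘(ℝ, E) 1 X] {c : ℝ → X} {s : ℝ}
    (h : ∀ᶠ t in 𝓝 s, HasVel c t (0 : E)) : ∀ᶠ t in 𝓝 s, c t = c s := by
  have hc : ContinuousAt c s := h.self_of_nhds.continuousAt
  have hsrc : ∀ᶠ t in 𝓝 s, c t ∈ (chartAt E (c s)).source :=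
    hc.eventually ((chartAt E (c s)).open_source.mem_nhds (mem_chart_source E (c s)))
  obtain ⟨ε, hε, hb⟩ := Metric.eventually_nhds_iff_ball.1 (h.and hsrc)
  refine Metric.eventually_nhds_iff_ball.2 ⟨ε, hε, fun t ht => ?_⟩
  have hd : ∀ t ∈ Metric.ball s ε, HasDerivAt (fun t => chartAt E (c s) (c t)) 0 t := by
    intro t ht
    have hm : MDAt E E (chartAt E (c s)) (c t) :=
      mdifferentiableAt_atlas (chart_mem_atlas E (c s)) (hb t ht).2
    have := HasVel.comp hm (hb t ht).1
    rw [map_zero] at this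
    exact hasVel_iff_hasDerivAt.1 this
  have e := (convex_ball s ε).is_const_of_fderivWithin_eq_zero (𝕜 := ℝ)
    (f := fun t => chartAt E (c s) (c t))
    (fun t ht => (hd t ht).differentiableAt.differentiableWithinAt)
    (fun t ht => by
      rw [fderivWithin_of_isOpen Metric.isOpen_ball ht]
      have := (hd t ht).hasFDerivAt.fderiv
      simpa using this) ht (Metric.mem_ball_self hε)
  exact (chartAt E (c s)).injOn (hb t ht).2 (mem_chart_source E (c s)) e

/-- A curve with vanishing velocity on a preconnected open set is constant there. -/
lemma eq_of_hasVel_zero [IsManifold 𝓘(ℝ, E) 1 X] {c : ℝ → X} {I : Set ℝ} (hI : IsOpen I)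
    (hI' : IsPreconnected I) (h : ∀ t ∈ I, HasVel c t (0 : E)) {s t : ℝ} (hs : s ∈ I)
    (ht : t ∈ I) : c s = c t := by
  have loc : ∀ s ∈ I, ∀ᶠ t in 𝓝 s, c t = c s := fun s hs =>
    eventually_eq_of_hasVel_zero (Filter.eventually_of_mem (hI.mem_nhds hs) h)
  have : PreconnectedSpace I := Subtype.preconnectedSpace hI'
  have : IsLocallyConstant fun t : I => c t := by
    rw [IsLocallyConstant.iff_eventually_eq]
    intro t
    exact (continuous_subtype_val.tendsto t).eventually (loc t t.2)
  exact this.apply_eq_of_preconnectedSpace ⟨s, hs⟩ ⟨t, ht⟩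

lemma isMIntegralCurveAt_iff_hasVel {c : ℝ → X} {s : ℝ}
    {V : ∀ x : X, TangentSpace 𝓘(ℝ, E) x} :
    IsMIntegralCurveAt c V s ↔ ∀ᶠ t in 𝓝 s, HasVel c t (toModel (V (c t))) :=
  Filter.eventually_congr (Filter.Eventually.of_forall fun _ => hasMFDerivAt_iff_hasVel _)

lemma isMIntegralCurveOn_iff_hasVel {c : ℝ → X} {I : Set ℝ} (hI : IsOpen I)
    {V : ∀ x : X, TangentSpace 𝓘(ℝ, E) x} :
    IsMIntegralCurveOn c V I ↔ ∀ t ∈ I, HasVel c t (toModel (V (c t))) :=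
  ⟨fun h t ht => (hasMFDerivAt_iff_hasVel _).1 ((h t ht).hasMFDerivAt (hI.mem_nhds ht)),
    fun h t ht => HasMFDerivAt.hasMFDerivWithinAt ((hasMFDerivAt_iff_hasVel _).2 (h t ht))⟩

end Velocity

/-! ### Smooth vector fields and equations on Lie groups -/

section Fields

variable {E : Type*} [NormedAddCommGroup E] [NormedSpace ℝ E]
  {X : Type*} [TopologicalSpace X] [ChartedSpace E X]

open Bundle in
/-- A smooth map into a vector space, seen as a map into one fixed tangent space. -/
lemma contMDiffAt_mk_const {H' E' N : Type*} [NormedAddCommGroup E'] [NormedSpace ℝ E']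
    [TopologicalSpace H'] {J : ModelWithCorners ℝ E' H'} [TopologicalSpace N] [ChartedSpace H' N]
    [IsManifold 𝓘(ℝ, E) 1 X] {n : ℕ∞ω} (x : X) {w : N → E} {y : N}
    (hw : ContMDiffAt J 𝓘(ℝ, E) n w y) :
    ContMDiffAt J 𝓘(ℝ, E).tangent n
      (fun z => (⟨x, w z⟩ : TangentBundle 𝓘(ℝ, E) X)) y := by
  refine Bundle.contMDiffAt_totalSpace.2 ⟨contMDiffAt_const, ?_⟩
  refine hw.congr_of_eventuallyEq (Filter.Eventually.of_forall fun z => ?_)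
  exact ((tangentBundleCore 𝓘(ℝ, E) X).coordChange_self (achart E x) x
    (mem_achart_source E x) (w z)).symm ▸ rfl

open Bundle in
/-- Left translates of a smooth family of Lie algebra vectors form a smooth family of tangent
vectors. -/
lemma contMDiffAt_mulInvariant {H' E' N : Type*} [NormedAddCommGroup E'] [NormedSpace ℝ E']
    [TopologicalSpace H'] {J : ModelWithCorners ℝ E' H'} [TopologicalSpace N] [ChartedSpace H' N]
    [Group X] [LieGroup 𝓘(ℝ, E) ∞ X] {w : N → E} {g : N → X} {y : N}
    (hg : ContMDiffAt J 𝓘(ℝ, E) ∞ g y) (hw : ContMDiffAt J 𝓘(ℝ, E) ∞ w y) :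
    ContMDiffAt J 𝓘(ℝ, E).tangent ∞
      (fun z => (⟨g z, mder E E (fun x : X => g z * x) 1 (w z)⟩ : TangentBundle 𝓘(ℝ, E) X)) y := by
  -- the translate is the value of the differential of the multiplication at `(0, w z)`
  have h1 : ContMDiffAt J 𝓘(ℝ, E).tangent ∞
      (fun z => (⟨g z, (0 : E)⟩ : TangentBundle 𝓘(ℝ, E) X)) y :=
    ((Bundle.contMDiff_zeroSection ℝ (TangentSpace 𝓘(ℝ, E) : X → Type _)).contMDiffAt
      (x := g y)).comp y hg
  have h2 : ContMDiffAt J 𝓘(ℝ, E).tangent ∞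
      (fun z => (⟨1, w z⟩ : TangentBundle 𝓘(ℝ, E) X)) y := contMDiffAt_mk_const 1 hw
  have h3 : ContMDiff (𝓘(ℝ, E).tangent.prod 𝓘(ℝ, E).tangent)
      (𝓘(ℝ, E).prod 𝓘(ℝ, E)).tangent ∞ (equivTangentBundleProd 𝓘(ℝ, E) X 𝓘(ℝ, E) X).symm :=
    contMDiff_equivTangentBundleProd_symm
  have h4 : ContMDiff (𝓘(ℝ, E).prod 𝓘(ℝ, E)).tangent 𝓘(ℝ, E).tangent ∞
      (tangentMap (𝓘(ℝ, E).prod 𝓘(ℝ, E)) 𝓘(ℝ, E) (fun p : X × X => p.1 * p.2)) :=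
    ContMDiff.contMDiff_tangentMap (contMDiff_mul 𝓘(ℝ, E) ∞) (by simp)
  have h5 := (h4.comp h3).contMDiffAt.comp y (h1.prodMk h2)
  refine h5.congr_of_eventuallyEq (Filter.Eventually.of_forall fun z => ?_)
  have e1 : (fun p : X × X => p.1 * p.2) (g z, 1) = g z := mul_one (g z)
  have e := mfderiv_prod_eq_add_apply (v := ((0, w z) : E × E))
    ((contMDiff_mul 𝓘(ℝ, E) ∞ (G := X)).mdifferentiable (by simp) (g z, 1))
  refine Bundle.TotalSpace.ext e1.symm ?_
  refine heq_of_eq ?_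
  change mder E E (fun x : X => g z * x) 1 (w z) =
    mfderiv (𝓘(ℝ, E).prod 𝓘(ℝ, E)) 𝓘(ℝ, E) (fun p : X × X => p.1 * p.2) (g z, 1) (0, w z)
  refine Eq.trans ?_ e.symm
  change _ = mder E E (fun x : X => x * 1) (g z) (0 : E) +
    mder E E (fun x : X => g z * x) 1 (w z)
  rw [map_zero, zero_add]

/-- The vector field `d/dt` on the line is smooth. -/
lemma contMDiff_unitField : ContMDiff 𝓘(ℝ, ℝ) 𝓘(ℝ, ℝ).tangent ∞
    (fun t => (⟨t, (1 : ℝ)⟩ : TangentBundle 𝓘(ℝ, ℝ) ℝ)) := by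
  intro t
  refine (Bundle.contMDiffAt_section
    (s := fun t : ℝ => (show TangentSpace 𝓘(ℝ, ℝ) t from (1 : ℝ))) t).2 ?_
  refine (contMDiffAt_const (c := (1 : ℝ))).congr_of_eventuallyEq
    (Filter.Eventually.of_forall fun x => ?_)
  refine (congrFun ((trivializationAt ℝ (TangentSpace 𝓘(ℝ, ℝ)) t).coe_linearMapAt_of_mem (R := ℝ)
    (b := x) (mem_univ _)) (1 : ℝ)).symm.trans ?_
  exact congrArg (fun L : ℝ →L[ℝ] ℝ => L 1) (TangentBundle.continuousLinearMapAt_model_space t x)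

/-- Solutions of a smooth autonomous ordinary differential equation are smooth. -/
lemma contDiffOn_of_hasDerivAt {F : E → E} {Ω : Set E} (hF : ContDiffOn ℝ ∞ F Ω) {c : ℝ → E}
    {U : Set ℝ} (hU : IsOpen U) (hc : ∀ t ∈ U, HasDerivAt c (F (c t)) t) (hm : MapsTo c U Ω) :
    ContDiffOn ℝ ∞ c U := by
  rw [contDiffOn_infty]
  intro n
  induction n with
  | zero => exact contDiffOn_zero.2 fun t ht => (hc t ht).continuousAt.continuousWithinAt
  | succ n ih =>
    push_cast
    rw [contDiffOn_succ_iff_deriv_of_isOpen hU]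
    refine ⟨fun t ht => (hc t ht).differentiableAt.differentiableWithinAt, by simp, ?_⟩
    exact ((hF.of_le (mod_cast le_top)).comp ih hm).congr fun t ht => (hc t ht).deriv

/-- Integral curves of smooth vector fields are smooth. -/
lemma contMDiffOn_of_hasVel [IsManifold 𝓘(ℝ, E) ∞ X] {V : ∀ x : X, TangentSpace 𝓘(ℝ, E) x}
    (hV : ContMDiff 𝓘(ℝ, E) 𝓘(ℝ, E).tangent ∞
      (fun x => (⟨x, V x⟩ : TangentBundle 𝓘(ℝ, E) X)))
    {c : ℝ → X} {I : Set ℝ} (hI : IsOpen I) (hc : ∀ t ∈ I, HasVel c t (toModel (V (c t)))) :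
    ContMDiffOn 𝓘(ℝ, ℝ) 𝓘(ℝ, E) ∞ c I := by
  intro s hs
  refine ContMDiffAt.contMDiffWithinAt ?_
  set φ := chartAt E (c s) with hφ
  set e := trivializationAt E (TangentSpace 𝓘(ℝ, E) : X → Type _) (c s) with he
  have hbase : e.baseSet = φ.source := rfl
  have h1 : ContMDiffOn 𝓘(ℝ, E) 𝓘(ℝ, E) ∞ (fun x => (e ⟨x, V x⟩).2) φ.source :=
    e.contMDiffOn_section_baseSet_iff.1 hV.contMDiffOn
  have h2 : ContDiffOn ℝ ∞ (fun y => (e ⟨φ.symm y, V (φ.symm y)⟩).2) φ.target :=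
    (h1.comp (contMDiffOn_chart_symm (x := c s)) fun y hy => φ.map_target hy).contDiffOn
  have hcont : ContinuousOn c I := fun t ht => (hc t ht).continuousAt.continuousWithinAt
  have hU : IsOpen (I ∩ c ⁻¹' φ.source) := hcont.isOpen_inter_preimage hI φ.open_source
  -- in the chart, the curve solves an autonomous equation with smooth right-hand side
  have h3 : ContDiffOn ℝ ∞ (fun t => φ (c t)) (I ∩ c ⁻¹' φ.source) := by
    refine contDiffOn_of_hasDerivAt h2 hU (fun t ht => ?_) fun t ht => φ.map_source ht.2
    have hm : MDAt E E φ (c t) := mdifferentiableAt_atlas (chart_mem_atlas E (c s)) ht.2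
    have := hasVel_iff_hasDerivAt.1 (HasVel.comp hm (hc t ht.1))
    convert! this using 1
    rw [φ.left_inv ht.2]
    have h4 := mfderiv_chartAt_eq_tangentCoordChange (I := 𝓘(ℝ, E)) ht.2
    exact (congrArg (fun L : E →L[ℝ] E => L (toModel (V (c t)))) h4).symm
  have hs' : s ∈ I ∩ c ⁻¹' φ.source := ⟨hs, mem_chart_source E (c s)⟩
  have h5 : ContMDiffAt 𝓘(ℝ, ℝ) 𝓘(ℝ, E) ∞ (fun t => φ.symm (φ (c t))) s :=
    ((contMDiffOn_chart_symm (x := c s)).contMDiffAt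
      (φ.open_target.mem_nhds (φ.map_source hs'.2))).comp s
      (h3.contDiffAt (hU.mem_nhds hs')).contMDiffAt
  refine h5.congr_of_eventuallyEq ?_
  filter_upwards [hU.mem_nhds hs'] with t ht
  exact (φ.left_inv ht.2).symm

end Fields

section OneParameter

variable {EG : Type*} [NormedAddCommGroup EG] [NormedSpace ℝ EG]
  {G : Type*} [TopologicalSpace G] [ChartedSpace EG G] [Group G] [LieGroup 𝓘(ℝ, EG) ∞ G]

lemma mdAt_mul_left (g x : G) : MDAt EG EG (fun y : G => g * y) x :=
  (contMDiff_mul_left (I := 𝓘(ℝ, EG)) (n := ∞) (a := g)).contMDiffAt.mdifferentiableAt (by simp)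

lemma mdAt_mul_right (g x : G) : MDAt EG EG (fun y : G => y * g) x :=
  (contMDiff_mul_right (I := 𝓘(ℝ, EG)) (n := ∞) (a := g)).contMDiffAt.mdifferentiableAt (by simp)

/-- The left-invariant vector field with value `v` at the identity. -/
def leftField (v : EG) (g : G) : TangentSpace 𝓘(ℝ, EG) g := mder EG EG (fun x : G => g * x) 1 v

lemma contMDiff_leftField (v : EG) : ContMDiff 𝓘(ℝ, EG) 𝓘(ℝ, EG).tangent ∞
    (fun g : G => (⟨g, leftField v g⟩ : TangentBundle 𝓘(ℝ, EG) G)) :=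
  fun _ => contMDiffAt_mulInvariant contMDiffAt_id contMDiffAt_const

lemma mder_mul_leftField (g h : G) (v : EG) :
    mder EG EG (fun x : G => g * x) h (leftField v h) = toModel (leftField v (g * h)) := by
  have := mder_comp (E := EG) (F := EG) (F' := EG) (f := fun x : G => h * x)
    (g := fun x : G => g * x) (x := 1) (mdAt_mul_left _ _) (mdAt_mul_left _ _) v
  simp only [mul_one, ← mul_assoc] at this
  exact this.symm

lemma HasVel.mul_left_leftField {c : ℝ → G} {s : ℝ} {v : EG} (g : G)
    (h : HasVel c s (toModel (leftField v (c s)))) :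
    HasVel (fun t => g * c t) s (toModel (leftField v (g * c s))) := by
  have := HasVel.comp (f := fun x => g * x) (mdAt_mul_left g _) h
  rwa [show mder EG EG (fun x : G => g * x) (c s) (toModel (leftField v (c s))) =
    toModel (leftField v (g * c s)) from mder_mul_leftField _ _ _] at this

/-- Integral curves of left-invariant vector fields are defined for all times, since the left
translates of one of them through `1` provide solutions on an interval of a fixed length. -/
lemma exists_isMIntegralCurve_leftField [CompleteSpace EG] [T2Space G] (v : EG) :
    ∃ φ : ℝ → G, φ 0 = 1 ∧ IsMIntegralCurve φ (leftField v) := by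
  have hv : ContMDiff 𝓘(ℝ, EG) 𝓘(ℝ, EG).tangent 1
    (fun g : G => (⟨g, leftField v g⟩ : TangentBundle 𝓘(ℝ, EG) G)) :=
    (contMDiff_leftField v).of_le (mod_cast le_top)
  obtain ⟨c, hc0, hc⟩ :=
    exists_isMIntegralCurveAt_of_contMDiffAt_boundaryless 0 (hv.contMDiffAt (x := (1 : G)))
  rw [isMIntegralCurveAt_iff_hasVel] at hc
  obtain ⟨ε, hε, hc⟩ := Metric.eventually_nhds_iff_ball.1 hc
  rw [Real.ball_eq_Ioo, zero_sub, zero_add] at hc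
  refine exists_isMIntegralCurve_of_isMIntegralCurveOn hv hε (fun g => ?_) 1
  refine ⟨fun t => g * c t, by simp [hc0], ?_⟩
  exact (isMIntegralCurveOn_iff_hasVel isOpen_Ioo).2 fun t ht => (hc t ht).mul_left_leftField g

/-- Every vector of the Lie algebra is the initial velocity of a one-parameter subgroup. -/
lemma exists_oneParameterSubgroup [CompleteSpace EG] [T2Space G] (v : EG) :
    ∃ φ : ℝ → G, ContMDiff 𝓘(ℝ, ℝ) 𝓘(ℝ, EG) ∞ φ ∧ (∀ s t, φ (s + t) = φ s * φ t) ∧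
      φ 0 = 1 ∧ ∀ t, HasVel φ t (toModel (leftField v (φ t))) := by
  have hv : ContMDiff 𝓘(ℝ, EG) 𝓘(ℝ, EG).tangent ∞
    (fun g : G => (⟨g, leftField v g⟩ : TangentBundle 𝓘(ℝ, EG) G)) := contMDiff_leftField v
  obtain ⟨φ, h0, hφ⟩ := exists_isMIntegralCurve_leftField (G := G) v
  have hvel : ∀ t, HasVel φ t (toModel (leftField v (φ t))) := fun t =>
    (hasMFDerivAt_iff_hasVel _).1 (hφ t)
  refine ⟨φ, ?_, fun s t => ?_, h0, hvel⟩
  · exact contMDiffOn_univ.1 (contMDiffOn_of_hasVel hv isOpen_univ fun t _ => hvel t)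
  · have h1 : IsMIntegralCurve (φ ∘ (· + s)) (leftField v) := hφ.comp_add s
    have h2 : IsMIntegralCurve (fun t => φ s * φ t) (leftField v) := fun t =>
      (hasMFDerivAt_iff_hasVel _).2 ((hvel t).mul_left_leftField (φ s))
    have := isMIntegralCurve_Ioo_eq_of_contMDiff_boundaryless (t₀ := 0)
      (hv.of_le (mod_cast le_top)) h1 h2 (by simp [h0])
    rw [add_comm]
    exact congrFun this t

/-- Solutions of the time-dependent equation `a' = a w(t)` in a Lie group, near a given time. -/
lemma exists_hasVel_leftField [CompleteSpace EG] {w : ℝ → EG} {s : ℝ} (hw : ContDiffAt ℝ ∞ w s) :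
    ∃ a : ℝ → G, a s = 1 ∧ ∀ᶠ t in 𝓝 s, HasVel a t (toModel (leftField (w t) (a t))) := by
  let J := 𝓘(ℝ, ℝ).prod 𝓘(ℝ, EG)
  -- the associated autonomous equation on `ℝ × G`
  let V : ∀ x : ℝ × G, TangentSpace J x := fun x =>
    ((1, leftField (w x.1) x.2) : ℝ × EG)
  have h1 : ContMDiffAt J 𝓘(ℝ, ℝ).tangent ∞
      (fun x : ℝ × G => (⟨x.1, (1 : ℝ)⟩ : TangentBundle 𝓘(ℝ, ℝ) ℝ)) (s, 1) :=
    (contMDiff_unitField (s, (1 : G)).1).comp (s, (1 : G)) contMDiffAt_fst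
  have h2 : ContMDiffAt J 𝓘(ℝ, EG).tangent ∞
      (fun x : ℝ × G => (⟨x.2, leftField (w x.1) x.2⟩ : TangentBundle 𝓘(ℝ, EG) G)) (s, 1) :=
    contMDiffAt_mulInvariant contMDiffAt_snd
      (hw.contMDiffAt.comp (s, (1 : G)) contMDiffAt_fst)
  have h3 : ContMDiff (𝓘(ℝ, ℝ).tangent.prod 𝓘(ℝ, EG).tangent) J.tangent ∞
      (equivTangentBundleProd 𝓘(ℝ, ℝ) ℝ 𝓘(ℝ, EG) G).symm := contMDiff_equivTangentBundleProd_symm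
  have hV : ContMDiffAt J J.tangent ∞ (fun x => (⟨x, V x⟩ : TangentBundle J (ℝ × G))) (s, 1) :=
    h3.contMDiffAt.comp (s, (1 : G)) (h1.prodMk h2)
  obtain ⟨c, hc0, hc⟩ := exists_isMIntegralCurveAt_of_contMDiffAt_boundaryless s
    (hV.of_le (mod_cast le_top))
  have hfst : ∀ᶠ t in 𝓝 s, HasVel (fun t => (c t).1) t (1 : ℝ) := by
    filter_upwards [hc] with t ht
    have := (hasMFDerivAt_fst (I := 𝓘(ℝ, ℝ)) (I' := 𝓘(ℝ, EG)) (c t)).comp t ht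
    exact (hasMFDerivAt_iff_hasVel (1 : ℝ)).1 this
  have hsnd : ∀ᶠ t in 𝓝 s, HasVel (fun t => (c t).2) t
      (toModel (leftField (w (c t).1) (c t).2)) := by
    filter_upwards [hc] with t ht
    have := (hasMFDerivAt_snd (I := 𝓘(ℝ, ℝ)) (I' := 𝓘(ℝ, EG)) (c t)).comp t ht
    exact (hasMFDerivAt_iff_hasVel (leftField (w (c t).1) (c t).2)).1 this
  have htime : ∀ᶠ t in 𝓝 s, (c t).1 = t := by
    have h4 : ∀ᶠ t in 𝓝 s, HasVel (fun t => (c t).1 - t) t (0 : ℝ) := by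
      filter_upwards [hfst] with t ht
      have := (hasVel_iff_hasDerivAt.1 ht).sub (hasDerivAt_id t)
      rw [sub_self] at this
      exact hasVel_iff_hasDerivAt.2 this
    filter_upwards [eventually_eq_of_hasVel_zero h4] with t ht
    simpa [hc0, sub_eq_zero] using ht
  refine ⟨fun t => (c t).2, congrArg Prod.snd hc0, ?_⟩
  filter_upwards [hsnd, htime] with t h4 h5
  rwa [h5] at h4

/-- The left logarithmic derivative of a solution of `a' = a w(t)` is `w`. -/
lemma HasVel.inv_mul {a : ℝ → G} {s : ℝ} {w : EG}
    (h : HasVel a s (toModel (leftField w (a s)))) :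
    HasVel (fun t => (a s)⁻¹ * a t) s w := by
  have := h.mul_left_leftField (a s)⁻¹
  rw [inv_mul_cancel] at this
  have e : toModel (leftField w (1 : G)) = w := by
    have := mder_id (1 : G) w
    simp only [leftField, one_mul]
    exact this
  rwa [e] at this

/-- A differentiable curve in a Lie group has a left logarithmic derivative. -/
lemma MDAt.exists_hasVel_inv_mul {q : ℝ → G} {s : ℝ} (h : MDAt ℝ EG q s) :
    ∃ ν : EG, HasVel (fun t => (q s)⁻¹ * q t) s ν :=
  ⟨_, HasVel.comp (f := fun x : G => (q s)⁻¹ * x) (mdAt_mul_left _ _) h.hasVel⟩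

end OneParameter

/-! ### The adjoint representation and the Lie bracket -/

section AdDeriv

variable {EG : Type*} [NormedAddCommGroup EG] [NormedSpace ℝ EG]
  {G : Type*} [TopologicalSpace G] [ChartedSpace EG G] [Group G]

variable (EG G) in
/-- The multiplication of `G` in the chart at the identity. -/
def chartMul (p : EG × EG) : EG :=
  chartAt EG (1 : G) ((chartAt EG (1 : G)).symm p.1 * (chartAt EG (1 : G)).symm p.2)

variable (EG G) in
/-- The coordinates of the identity in the chart at the identity. -/
def chartOne : EG := chartAt EG (1 : G) 1

variable (EG G) in
/-- The differential at the identity of the left translation by the element with coordinates `x`,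
in the chart at the identity. -/
def chartLeft (x : EG) : EG →L[ℝ] EG :=
  (fderiv ℝ (chartMul EG G) (x, chartOne EG G)).comp (ContinuousLinearMap.inr ℝ EG EG)

variable (EG G) in
/-- The differential at the identity of the right translation by the element with coordinates `x`,
in the chart at the identity. -/
def chartRight (x : EG) : EG →L[ℝ] EG :=
  (fderiv ℝ (chartMul EG G) (chartOne EG G, x)).comp (ContinuousLinearMap.inl ℝ EG EG)

variable (G) in
omit [NormedSpace ℝ EG] in
lemma chart_one_symm : (chartAt EG (1 : G)).symm (chartOne EG G) = 1 :=
  (chartAt EG (1 : G)).left_inv (mem_chart_source EG (1 : G))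

variable (G) in
omit [NormedSpace ℝ EG] in
lemma chartOne_mem : chartOne EG G ∈ (chartAt EG (1 : G)).target :=
  (chartAt EG (1 : G)).map_source (mem_chart_source EG (1 : G))

variable [LieGroup 𝓘(ℝ, EG) ∞ G]

variable (G) in
lemma contDiffAt_chartMul {p : EG × EG} (h1 : p.1 ∈ (chartAt EG (1 : G)).target)
    (h2 : p.2 ∈ (chartAt EG (1 : G)).target)
    (h3 : (chartAt EG (1 : G)).symm p.1 * (chartAt EG (1 : G)).symm p.2 ∈
      (chartAt EG (1 : G)).source) : ContDiffAt ℝ ∞ (chartMul EG G) p := by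
  set φ := chartAt EG (1 : G)
  have hs : ∀ x ∈ φ.target, ContMDiffAt 𝓘(ℝ, EG) 𝓘(ℝ, EG) ∞ φ.symm x := fun x hx =>
    (contMDiffOn_chart_symm (x := (1 : G))).contMDiffAt (φ.open_target.mem_nhds hx)
  have ht : ContMDiffAt 𝓘(ℝ, EG) 𝓘(ℝ, EG) ∞ φ (φ.symm p.1 * φ.symm p.2) :=
    (contMDiffOn_chart (x := (1 : G))).contMDiffAt (φ.open_source.mem_nhds h3)
  rw [← contMDiffAt_iff_contDiffAt]
  refine ContMDiffAt.comp p ht (ContMDiffAt.mul ?_ ?_)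
  · exact ContMDiffAt.comp p (hs _ h1) contDiff_fst.contMDiff.contMDiffAt
  · exact ContMDiffAt.comp p (hs _ h2) contDiff_snd.contMDiff.contMDiffAt

lemma mdAt_chart {y : G} (hy : y ∈ (chartAt EG (1 : G)).source) :
    MDAt EG EG (chartAt EG (1 : G)) y :=
  mdifferentiableAt_atlas (chart_mem_atlas EG (1 : G)) hy

lemma mdAt_chart_symm {x : EG} (hx : x ∈ (chartAt EG (1 : G)).target) :
    MDAt EG EG (chartAt EG (1 : G)).symm x :=
  mdifferentiableAt_atlas_symm (chart_mem_atlas EG (1 : G)) hx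

variable (G) in
lemma mder_chart_one (v : EG) : mder EG EG (chartAt EG (1 : G)) 1 v = v := by
  have := mfderiv_extChartAt_self (I := 𝓘(ℝ, EG)) (x := (1 : G))
  simp only [mfld_simps] at this
  exact congrArg (fun L : EG →L[ℝ] EG => L v) this

variable (G) in
lemma mder_chart_symm_one (v : EG) :
    mder EG EG (chartAt EG (1 : G)).symm (chartOne EG G) v = v := by
  set φ := chartAt EG (1 : G)
  have h := mder_comp (E := EG) (F := EG) (F' := EG) (f := φ.symm) (g := φ) (x := chartOne EG G)
    (mdAt_chart (φ.map_target (chartOne_mem G))) (mdAt_chart_symm (chartOne_mem G)) v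
  rw [chart_one_symm, mder_chart_one] at h
  rw [← h, mder_congr (g := fun x => x), mder_id]
  filter_upwards [φ.open_target.mem_nhds (chartOne_mem G)] with x hx
  exact φ.right_inv hx

lemma chartLeft_apply {y : G} (hy : y ∈ (chartAt EG (1 : G)).source) (v : EG) :
    chartLeft EG G (chartAt EG (1 : G) y) v =
      mder EG EG (chartAt EG (1 : G)) y (mder EG EG (fun x : G => y * x) 1 v) := by
  set φ := chartAt EG (1 : G)
  have hd : DifferentiableAt ℝ (chartMul EG G) (φ y, chartOne EG G) :=
    (contDiffAt_chartMul G (φ.map_source hy) (chartOne_mem G) (by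
      change φ.symm (φ y) * φ.symm (chartOne EG G) ∈ φ.source
      rwa [φ.left_inv hy, show φ.symm (chartOne EG G) = 1 from chart_one_symm G,
        mul_one])).differentiableAt (by simp)
  have h1 : fderiv ℝ (fun z => chartMul EG G (φ y, z)) (chartOne EG G) v =
      chartLeft EG G (φ y) v := by
    have := hd.hasFDerivAt.comp (chartOne EG G) (hasFDerivAt_prodMk_right (φ y) (chartOne EG G))
    rw [show (fun z => chartMul EG G (φ y, z)) = chartMul EG G ∘ (fun z => (φ y, z)) from rfl,
      this.fderiv]
    rfl
  have h2 : (fun z => chartMul EG G (φ y, z)) = fun z => φ (y * φ.symm z) := by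
    funext z
    simp [chartMul, φ, φ.left_inv hy]
  rw [← h1, h2, ← mder_eq_fderiv]
  have h3 := mder_comp (E := EG) (F := EG) (F' := EG) (f := fun z => y * φ.symm z) (g := φ)
    (x := chartOne EG G) (mdAt_chart (by simpa [φ, chart_one_symm] using hy))
    (MDAt.comp (g := fun z => y * z) (mdAt_mul_left _ _) (mdAt_chart_symm (chartOne_mem G))) v
  rw [h3, mder_comp (g := fun z => y * z) (f := φ.symm) (mdAt_mul_left _ _)
    (mdAt_chart_symm (chartOne_mem G)), mder_chart_symm_one, chart_one_symm, mul_one]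

lemma chartRight_apply {y : G} (hy : y ∈ (chartAt EG (1 : G)).source) (v : EG) :
    chartRight EG G (chartAt EG (1 : G) y) v =
      mder EG EG (chartAt EG (1 : G)) y (mder EG EG (fun x : G => x * y) 1 v) := by
  set φ := chartAt EG (1 : G)
  have hd : DifferentiableAt ℝ (chartMul EG G) (chartOne EG G, φ y) :=
    (contDiffAt_chartMul G (chartOne_mem G) (φ.map_source hy) (by
      change φ.symm (chartOne EG G) * φ.symm (φ y) ∈ φ.source
      rwa [φ.left_inv hy, show φ.symm (chartOne EG G) = 1 from chart_one_symm G,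
        one_mul])).differentiableAt (by simp)
  have h1 : fderiv ℝ (fun z => chartMul EG G (z, φ y)) (chartOne EG G) v =
      chartRight EG G (φ y) v := by
    have := HasFDerivAt.comp (f := fun z => (z, φ y)) (chartOne EG G) hd.hasFDerivAt
      (hasFDerivAt_prodMk_left (chartOne EG G) (φ y))
    rw [show (fun z => chartMul EG G (z, φ y)) = chartMul EG G ∘ (fun z => (z, φ y)) from rfl,
      this.fderiv]
    rfl
  have h2 : (fun z => chartMul EG G (z, φ y)) = fun z => φ (φ.symm z * y) := by
    funext z
    simp [chartMul, φ, φ.left_inv hy]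
  rw [← h1, h2, ← mder_eq_fderiv]
  have h3 := mder_comp (E := EG) (F := EG) (F' := EG) (f := fun z => φ.symm z * y) (g := φ)
    (x := chartOne EG G) (mdAt_chart (by simpa [φ, chart_one_symm] using hy))
    (MDAt.comp (g := fun z => z * y) (mdAt_mul_right _ _) (mdAt_chart_symm (chartOne_mem G))) v
  rw [h3, mder_comp (g := fun z => z * y) (f := φ.symm) (mdAt_mul_right _ _)
    (mdAt_chart_symm (chartOne_mem G)), mder_chart_symm_one, chart_one_symm, one_mul]

variable (G) in
lemma chartLeft_one (v : EG) : chartLeft EG G (chartOne EG G) v = v := by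
  rw [chartOne, chartLeft_apply (mem_chart_source EG (1 : G)), mder_chart_one]
  simp only [one_mul, mder_id]

variable (G) in
lemma chartRight_one (v : EG) : chartRight EG G (chartOne EG G) v = v := by
  rw [chartOne, chartRight_apply (mem_chart_source EG (1 : G)), mder_chart_one]
  simp only [mul_one, mder_id]

/-- The adjoint action, as an endomorphism of the model vector space. -/
def adE (g : G) : EG →L[ℝ] EG := Ad (EG := EG) g

omit [LieGroup 𝓘(ℝ, EG) ∞ G] in
lemma adE_eq_mder (g : G) : adE (EG := EG) g =
    (mder EG EG (fun x : G => g * x * g⁻¹) 1) := rfl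

/-- Left translation by `y` is conjugation by `y` followed by right translation by `y`. -/
lemma chartRight_adE {y : G} (hy : y ∈ (chartAt EG (1 : G)).source) (v : EG) :
    chartRight EG G (chartAt EG (1 : G) y) (adE y v) = chartLeft EG G (chartAt EG (1 : G) y) v := by
  rw [chartRight_apply hy, chartLeft_apply hy, adE_eq_mder]
  congr 1
  have h := mder_comp (E := EG) (F := EG) (F' := EG) (f := fun x : G => y * x * y⁻¹)
    (g := fun x : G => x * y) (x := 1) (mdAt_mul_right _ _)
    ((contMDiff_conj y).contMDiffAt.mdifferentiableAt (by simp)) v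
  simp only [inv_mul_cancel_right] at h
  rw [h]
  simp

variable (G) in
lemma differentiableAt_fderiv_chartMul :
    DifferentiableAt ℝ (fderiv ℝ (chartMul EG G)) (chartOne EG G, chartOne EG G) :=
  ((contDiffAt_chartMul G (p := (chartOne EG G, chartOne EG G)) (chartOne_mem G) (chartOne_mem G)
    (by simp [chart_one_symm])).fderiv_right (m := 1)
      (by rw [one_add_one_eq_two]; exact ENat.LEInfty.out)).differentiableAt (by simp)

variable (EG G) in
/-- The second differential at the identity of the multiplication, in the chart at the identity. -/
def chartMul₂ : EG × EG →L[ℝ] EG × EG →L[ℝ] EG :=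
  fderiv ℝ (fderiv ℝ (chartMul EG G)) (chartOne EG G, chartOne EG G)

lemma chartMul₂_symm (v w : EG × EG) : chartMul₂ EG G v w = chartMul₂ EG G w v :=
  ((contDiffAt_chartMul G (p := (chartOne EG G, chartOne EG G)) (chartOne_mem G) (chartOne_mem G)
    (by simp [chart_one_symm])).isSymmSndFDerivAt
    (by rw [minSmoothness_of_isRCLikeNormedField]; exact ENat.LEInfty.out)) v w

omit [LieGroup 𝓘(ℝ, EG) ∞ G] [Group G] [ChartedSpace EG G] [TopologicalSpace G] in
lemma hasDerivAt_comp_right {E F : Type*} [NormedAddCommGroup E] [NormedSpace ℝ E]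
    [NormedAddCommGroup F] [NormedSpace ℝ F] (j : E →L[ℝ] F) {c : ℝ → F →L[ℝ] EG}
    {c' : F →L[ℝ] EG} {s : ℝ} (h : HasDerivAt c c' s) :
    HasDerivAt (fun t => (c t).comp j) (c'.comp j) s :=
  ((ContinuousLinearMap.compL ℝ E F EG).flip j).hasFDerivAt.comp_hasDerivAt s h

lemma hasDerivAt_chartLeft {c : ℝ → EG} {s : ℝ} {v : EG} (h : HasDerivAt c v s)
    (hc : c s = chartOne EG G) : HasDerivAt (fun t => chartLeft EG G (c t))
      ((chartMul₂ EG G (v, 0)).comp (ContinuousLinearMap.inr ℝ EG EG)) s := by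
  have h1 : HasDerivAt (fun t => (c t, chartOne EG G)) (v, 0) s :=
    h.prodMk (hasDerivAt_const s _)
  have h2 : HasFDerivAt (fderiv ℝ (chartMul EG G)) (chartMul₂ EG G) (c s, chartOne EG G) := by
    rw [hc]
    exact (differentiableAt_fderiv_chartMul G).hasFDerivAt
  exact hasDerivAt_comp_right (ContinuousLinearMap.inr ℝ EG EG) (h2.comp_hasDerivAt s h1)

lemma hasDerivAt_chartRight {c : ℝ → EG} {s : ℝ} {v : EG} (h : HasDerivAt c v s)
    (hc : c s = chartOne EG G) : HasDerivAt (fun t => chartRight EG G (c t))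
      ((chartMul₂ EG G (0, v)).comp (ContinuousLinearMap.inl ℝ EG EG)) s := by
  have h1 : HasDerivAt (fun t => (chartOne EG G, c t)) (0, v) s :=
    (hasDerivAt_const s _).prodMk h
  have h2 : HasFDerivAt (fderiv ℝ (chartMul EG G)) (chartMul₂ EG G) (chartOne EG G, c s) := by
    rw [hc]
    exact (differentiableAt_fderiv_chartMul G).hasFDerivAt
  exact hasDerivAt_comp_right (ContinuousLinearMap.inl ℝ EG EG) (h2.comp_hasDerivAt s h1)

variable (G) in
lemma hasFDerivAt_chartLeft_apply (Y : EG) : HasFDerivAt (fun x => chartLeft EG G x Y)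
    ((ContinuousLinearMap.apply ℝ EG ((0, Y) : EG × EG)).comp
      ((chartMul₂ EG G).comp (ContinuousLinearMap.inl ℝ EG EG))) (chartOne EG G) := by
  have h := (differentiableAt_fderiv_chartMul G (EG := EG)).hasFDerivAt.comp (chartOne EG G)
    (f := fun x => (x, chartOne EG G)) (hasFDerivAt_prodMk_left _ _)
  exact (ContinuousLinearMap.apply ℝ EG ((0, Y) : EG × EG)).hasFDerivAt.comp _ h

/-- In the chart at the identity, the left-invariant vector fields are given by `chartLeft`. -/
lemma mpullback_mulInvariant_eq (X : GroupLieAlgebra 𝓘(ℝ, EG) G) {x : EG}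
    (hx : x ∈ (chartAt EG (1 : G)).target) :
    toModel (VectorField.mpullback 𝓘(ℝ, EG) 𝓘(ℝ, EG) (chartAt EG (1 : G)).symm
      (mulInvariantVectorField X) x) = chartLeft EG G x (toModel X) := by
  set φ := chartAt EG (1 : G)
  have h1 : (mder EG EG φ.symm x).inverse = mder EG EG φ (φ.symm x) := by
    refine ContinuousLinearMap.inverse_eq ?_ ?_
    · ext v
      have := mder_comp (E := EG) (F := EG) (F' := EG) (f := φ) (g := φ.symm) (x := φ.symm x)
        (by rw [φ.right_inv hx]; exact mdAt_chart_symm hx) (mdAt_chart (φ.map_target hx)) v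
      rw [φ.right_inv hx] at this
      rw [ContinuousLinearMap.comp_apply, ← this, mder_congr (g := fun x => x), mder_id]
      · rfl
      · filter_upwards [φ.open_source.mem_nhds (φ.map_target hx)] with y hy
        exact φ.left_inv hy
    · ext v
      have := mder_comp (E := EG) (F := EG) (F' := EG) (f := φ.symm) (g := φ) (x := x)
        (mdAt_chart (φ.map_target hx)) (mdAt_chart_symm hx) v
      rw [ContinuousLinearMap.comp_apply, ← this, mder_congr (g := fun x => x), mder_id]
      · rfl
      · filter_upwards [φ.open_target.mem_nhds hx] with y hy
        exact φ.right_inv hy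
  have h2 := chartLeft_apply (φ.map_target hx) (toModel X)
  rw [show chartAt EG (1 : G) (φ.symm x) = x from φ.right_inv hx] at h2
  rw [h2]
  exact congrArg (fun L : EG →L[ℝ] EG => L (mder EG EG (fun y : G => φ.symm x * y) 1 X)) h1

variable (G) in
/-- The Lie bracket is the antisymmetrization of the mixed second differential of the
multiplication, in the chart at the identity. -/
lemma bracket_eq_chart (X Y : GroupLieAlgebra 𝓘(ℝ, EG) G) :
    toModel ⁅X, Y⁆ = chartMul₂ EG G (toModel X, 0) (0, toModel Y) -
      chartMul₂ EG G (toModel Y, 0) (0, toModel X) := by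
  have h1 : toModel ⁅X, Y⁆ = VectorField.lieBracket ℝ (fun x => chartLeft EG G x (toModel X))
      (fun x => chartLeft EG G x (toModel Y)) (chartOne EG G) := by
    rw [GroupLieAlgebra.bracket_def, ← VectorField.mlieBracketWithin_univ,
      VectorField.mlieBracketWithin_apply, mfderiv_extChartAt_self]
    have h2 : (ContinuousLinearMap.id ℝ EG).inverse = ContinuousLinearMap.id ℝ EG :=
      ContinuousLinearMap.inverse_id
    refine (congrArg (fun L : EG →L[ℝ] EG => L _) h2).trans ?_
    rw [ContinuousLinearMap.id_apply]
    simp only [mfld_simps, preimage_univ, VectorField.mpullbackWithin_univ]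
    have h3 : ∀ Z : GroupLieAlgebra 𝓘(ℝ, EG) G, ∀ᶠ x in 𝓝 (chartOne EG G),
        toModel (VectorField.mpullback 𝓘(ℝ, EG) 𝓘(ℝ, EG) (chartAt EG (1 : G)).symm
          (mulInvariantVectorField Z) x) = chartLeft EG G x (toModel Z) := fun Z => by
      filter_upwards [(chartAt EG (1 : G)).open_target.mem_nhds (chartOne_mem G)] with x hx
      exact mpullback_mulInvariant_eq Z hx
    refine Eq.trans ?_ (Filter.EventuallyEq.lieBracket_vectorField_eq (𝕜 := ℝ) (h3 X) (h3 Y))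
    rw [← VectorField.lieBracketWithin_univ]
    rfl
  rw [h1, VectorField.lieBracket, (hasFDerivAt_chartLeft_apply G _).fderiv,
    (hasFDerivAt_chartLeft_apply G _).fderiv, chartLeft_one, chartLeft_one]
  rfl

variable [CompleteSpace EG]

/-- The differential at `1` of the adjoint representation is the Lie bracket: in the chart at the
identity `Ad g` is the quotient of the differentials of the left and the right translation by `g`,
whose derivatives are the two partial second differentials of the multiplication. -/
lemma hasDerivAt_adE_one {k : ℝ → G} {s : ℝ} (hk : k s = 1) {ν : GroupLieAlgebra 𝓘(ℝ, EG) G}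
    (h : HasVel k s (toModel ν)) :
    ∃ A : EG →L[ℝ] EG, (∀ Y : GroupLieAlgebra 𝓘(ℝ, EG) G, A (toModel Y) = toModel ⁅ν, Y⁆) ∧
      HasDerivAt (fun t => adE (EG := EG) (k t)) A s := by
  set φ := chartAt EG (1 : G)
  have hc : HasDerivAt (fun t => φ (k t)) (toModel ν) s := by
    have h1 := HasVel.comp (E := EG) (F := EG) (f := φ) (c := k) (s := s)
      (by rw [hk]; exact mdAt_chart (mem_chart_source EG (1 : G))) h
    rw [hk, mder_chart_one] at h1
    exact hasVel_iff_hasDerivAt.1 h1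
  have hc1 : φ (k s) = chartOne EG G := by rw [hk]; rfl
  have hL := hasDerivAt_chartLeft hc hc1
  have hR := hasDerivAt_chartRight hc hc1
  have hR1 : chartRight EG G (φ (k s)) = 1 := by
    rw [hc1]; ext v; exact chartRight_one G v
  have hL1 : chartLeft EG G (φ (k s)) = 1 := by
    rw [hc1]; ext v; exact chartLeft_one G v
  have hinv : HasFDerivAt Ring.inverse
      (-ContinuousLinearMap.mulLeftRight ℝ (EG →L[ℝ] EG) 1 1) (chartRight EG G (φ (k s))) := by
    rw [hR1]
    simpa using hasFDerivAt_ringInverse (𝕜 := ℝ) (1 : (EG →L[ℝ] EG)ˣ)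
  have hprod := (hinv.comp_hasDerivAt s hR).mul hL
  refine ⟨_, fun Y => ?_, hprod.congr_of_eventuallyEq ?_⟩
  · simp only [Function.comp_apply, hR1, hL1, Ring.inverse_one]
    rw [bracket_eq_chart, chartMul₂_symm (toModel Y, 0)]
    simp [ContinuousLinearMap.mulLeftRight_apply, sub_eq_neg_add]
  · have hu : ∀ᶠ t in 𝓝 s, IsUnit (chartRight EG G (φ (k t))) := by
      refine hR.continuousAt.eventually (Units.isOpen.mem_nhds ?_)
      exact (congrArg IsUnit hR1).mpr isUnit_one
    have hsrc : ∀ᶠ t in 𝓝 s, k t ∈ φ.source := by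
      refine h.continuousAt.eventually (φ.open_source.mem_nhds ?_)
      rw [hk]
      exact mem_chart_source EG (1 : G)
    filter_upwards [hu, hsrc] with t h1 h2
    have h3 : chartRight EG G (φ (k t)) * adE (k t) = chartLeft EG G (φ (k t)) := by
      ext v
      exact chartRight_adE h2 v
    change adE (k t) = Ring.inverse (chartRight EG G (φ (k t))) * chartLeft EG G (φ (k t))
    rw [← h3, Ring.inverse_mul_cancel_left _ _ h1]

omit [CompleteSpace EG] in
lemma adE_mul (g h : G) (v : EG) : adE (g * h) v = adE g (adE h v) := Ad_mul g h v

omit [CompleteSpace EG] [LieGroup 𝓘(ℝ, EG) ∞ G] in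
variable (G) in
lemma adE_one (v : EG) : adE (1 : G) v = v :=
  congrArg (fun L : EG →L[ℝ] EG => L v) Ad_one

omit [CompleteSpace EG] in
@[simp] lemma adE_inv_adE (g : G) (v : EG) : adE g⁻¹ (adE g v) = v := by
  rw [← adE_mul, inv_mul_cancel, adE_one]

omit [CompleteSpace EG] in
@[simp] lemma adE_adE_inv (g : G) (v : EG) : adE g (adE g⁻¹ v) = v := by
  rw [← adE_mul, mul_inv_cancel, adE_one]

/-- The derivative of `Ad (q t) (f t)`, in terms of the left logarithmic derivative `ν` of `q`. -/
lemma hasDerivAt_adE_apply {q : ℝ → G} {s : ℝ} {ν : GroupLieAlgebra 𝓘(ℝ, EG) G}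
    (hq : HasVel (fun t => (q s)⁻¹ * q t) s (toModel ν))
    {f : ℝ → GroupLieAlgebra 𝓘(ℝ, EG) G} {f' : EG}
    (hf : HasDerivAt (fun t => toModel (f t)) f' s) :
    HasDerivAt (fun t => adE (q t) (toModel (f t))) (adE (q s) (f' + toModel ⁅ν, f s⁆)) s := by
  obtain ⟨A, hA, hd⟩ := hasDerivAt_adE_one (by simp) hq
  have h1 := (adE (EG := EG) (q s)).hasFDerivAt.comp_hasDerivAt s (hd.clm_apply hf)
  convert! h1 using 1
  · funext t
    simp [← adE_mul]
  · rw [inv_mul_cancel, adE_one, hA, add_comm]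

end AdDeriv

/-! ### Differentiating in the principal bundle -/

section Cartan

variable {EG : Type*} [NormedAddCommGroup EG] [NormedSpace ℝ EG] [CompleteSpace EG]
  {G : Type*} [TopologicalSpace G] [ChartedSpace EG G] [Group G] [LieGroup 𝓘(ℝ, EG) ∞ G]
  {EP : Type*} [NormedAddCommGroup EP] [NormedSpace ℝ EP]
  {P : Subgroup G} [ChartedSpace EP P]
  {EB : Type*} [NormedAddCommGroup EB] [NormedSpace ℝ EB]
  {B : Type*} [TopologicalSpace B] [ChartedSpace EB B] [IsManifold 𝓘(ℝ, EB) ∞ B]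
  {EM : Type*} [NormedAddCommGroup EM] [NormedSpace ℝ EM]
  {M : Type*} [TopologicalSpace M] [ChartedSpace EM M]

namespace CartanGeometry

variable (C : CartanGeometry EG EP EB B EM M P)

/-- The Cartan connection, as a map between the model vector spaces. -/
def form (e : B) : EB ≃L[ℝ] EG := C.conn e

variable (EG EP P) in
/-- The inclusion of Lie algebras `Lie P → 𝔤`, as a map between the model vector spaces. -/
def lieIncl : EP →L[ℝ] EG := mder EP EG (fun p : P => (p : G)) 1

lemma mdAt_proj (e : B) : MDAt EB EM C.proj e :=
  C.smooth_proj.contMDiffAt.mdifferentiableAt (by simp)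

lemma mdAt_act₂ (x : B × P) :
    MDifferentiableAt (𝓘(ℝ, EB).prod 𝓘(ℝ, EP)) 𝓘(ℝ, EB) (fun x : B × P => C.act x.1 x.2) x :=
  C.smooth_act.contMDiffAt.mdifferentiableAt (by simp)

lemma mdAt_act_left (p : P) (e : B) : MDAt EB EB (fun e => C.act e p) e :=
  MDAt.comp₂ (C.mdAt_act₂ _) mdifferentiableAt_id mdifferentiableAt_const

lemma mdAt_act_right (e : B) (p : P) : MDAt EP EB (fun p => C.act e p) p :=
  MDAt.comp₂ (C.mdAt_act₂ _) mdifferentiableAt_const mdifferentiableAt_id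

lemma form_mder_act (e : B) (p : P) (v : EB) :
    C.form (C.act e p) (mder EB EB (fun e' => C.act e' p) e v) =
      adE (p : G)⁻¹ (C.form e v) := C.equivariant e p v

/-- The Cartan connection reproduces the generators of the action of `P`. -/
lemma form_mder_orbit (e : B) (w : EP) :
    C.form e (mder EP EB (fun p : P => C.act e p) 1 w) = lieIncl EG EP P w := by
  have h : C.form (C.act e 1) (mder EP EB (fun p : P => C.act e p) 1 w) = lieIncl EG EP P w :=
    C.vertical e w
  rwa [C.act_one] at h

lemma proj_mder_act (e : B) (p : P) (v : EB) :
    mder EB EM C.proj (C.act e p) (mder EB EB (fun e' => C.act e' p) e v) =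
      mder EB EM C.proj e v := by
  rw [← mder_comp (g := C.proj) (f := fun e' => C.act e' p) (C.mdAt_proj _) (C.mdAt_act_left p e)]
  simp only [C.proj_act]

lemma proj_mder_orbit (e : B) (w : EP) :
    mder EB EM C.proj e (mder EP EB (fun p : P => C.act e p) 1 w) = 0 := by
  have := mder_comp (g := C.proj) (f := fun p : P => C.act e p) (x := 1) (C.mdAt_proj _)
    (C.mdAt_act_right e 1) w
  simp only [C.proj_act, mder_const, C.act_one] at this
  exact this.symm

/-- The velocity of a moving point of the bundle translated by a moving element of the group. -/
lemma hasVel_act {c : ℝ → B} {q : ℝ → P} {s : ℝ} {v : EB} {ν : EP} (hc : HasVel c s v)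
    (hq : HasVel (fun t => (q s)⁻¹ * q t) s ν) :
    ∃ z : EB, HasVel (fun t => C.act (c t) (q t)) s z ∧
      C.form (C.act (c s) (q s)) z = adE (q s : G)⁻¹ (C.form (c s) v) + lieIncl EG EP P ν := by
  have h1 := HasVel.comp₂ (C.mdAt_act₂ _) (HasVel.comp (C.mdAt_act_left (q s) (c s)) hc) hq
  simp only [← C.act_mul, mul_inv_cancel_left, inv_mul_cancel] at h1
  simp only [C.act_one, mder_id] at h1
  refine ⟨_, h1, ?_⟩
  rw [map_add, form_mder_act]
  congr 1
  simp only [C.act_mul]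
  exact C.form_mder_orbit _ _

/-- The action of `P` on the fibres is free. -/
lemma act_injective {e : B} {p q : P} (h : C.act e p = C.act e q) : p = q := by
  obtain ⟨U, hU, hx, Φ, hs, ht, -, -, h1, h2⟩ := C.locally_trivial (C.proj e)
  have he : e ∈ Φ.source := by rw [hs]; exact hx
  have h3 := h2 e he p
  rw [h, h2 e he q] at h3
  exact (mul_left_cancel h3).symm

/-- Near each point, on a union of fibres, the component `Ψ` in the group of a local trivialization
measures the difference of two points of the same fibre. -/
lemma exists_trivialization (e : B) : ∃ (W : Set B) (Ψ : B → P), IsOpen W ∧ e ∈ W ∧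
    ContMDiffOn 𝓘(ℝ, EB) 𝓘(ℝ, EP) ∞ Ψ W ∧
    (∀ e₁ e₂, e₁ ∈ W → C.proj e₂ = C.proj e₁ → e₂ ∈ W) ∧
    ∀ e₁ e₂, e₁ ∈ W → C.proj e₂ = C.proj e₁ → e₂ = C.act e₁ ((Ψ e₁)⁻¹ * Ψ e₂) := by
  obtain ⟨U, hU, hx, Φ, hs, ht, h3, h4, h1, h2⟩ := C.locally_trivial (C.proj e)
  have hW : ∀ e₁ e₂, e₁ ∈ Φ.source → C.proj e₂ = C.proj e₁ → e₂ ∈ Φ.source := by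
    intro e₁ e₂ he h
    rw [hs] at he ⊢
    exact (congrArg (· ∈ U) h).mpr he
  refine ⟨Φ.source, fun e => (Φ e).2, Φ.open_source, by rw [hs]; exact hx,
    contMDiff_snd.comp_contMDiffOn h3, hW, fun e₁ e₂ he h => ?_⟩
  have ha : C.act e₁ ((Φ e₁).2⁻¹ * (Φ e₂).2) ∈ Φ.source := hW e₁ _ he (C.proj_act _ _)
  refine Φ.injOn (hW e₁ e₂ he h) ha (Prod.ext ?_ ?_)
  · rw [h1 _ ha, h1 _ (hW e₁ e₂ he h), C.proj_act, h]
  · rw [h2 _ he, mul_inv_cancel_left]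

variable [LieGroup 𝓘(ℝ, EP) ∞ P]

/-- Two differentiable lifts of the same curve differ by a differentiable curve in `P`. -/
lemma exists_act_curve {c d : ℝ → B} {s : ℝ} (hc : MDAt ℝ EB c s) (hd : MDAt ℝ EB d s)
    (h : ∀ᶠ t in 𝓝 s, C.proj (d t) = C.proj (c t)) :
    ∃ q : ℝ → P, MDAt ℝ EP q s ∧ ∀ᶠ t in 𝓝 s, d t = C.act (c t) (q t) := by
  obtain ⟨W, Ψ, hWo, he, hΨ, hW, h2⟩ := C.exists_trivialization (c s)
  have hm : ∀ e ∈ W, MDAt EB EP Ψ e := fun e he =>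
    (hΨ.contMDiffAt (hWo.mem_nhds he)).mdifferentiableAt (by simp)
  have h1 : MDAt ℝ EP (fun t => (Ψ (c t))⁻¹ * Ψ (d t)) s := by
    have a1 : MDAt ℝ EP (fun t => (Ψ (c t))⁻¹) s :=
      MDAt.comp (g := fun p : P => p⁻¹) ((contMDiff_inv 𝓘(ℝ, EP) ∞).mdifferentiable (by simp) _)
        (MDAt.comp (hm _ he) hc)
    have a2 : MDAt ℝ EP (fun t => Ψ (d t)) s :=
      MDAt.comp (hm _ (hW _ _ he h.self_of_nhds)) hd
    exact MDAt.comp₂ ((contMDiff_mul 𝓘(ℝ, EP) ∞).mdifferentiable (by simp) _) a1 a2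
  refine ⟨_, h1, ?_⟩
  filter_upwards [h, hc.continuousAt.eventually (hWo.mem_nhds he)] with t h3 h4
  exact h2 _ _ h4 h3

/-- The kernel of the differential of the projection consists of the vertical vectors. -/
lemma mder_proj_eq_zero_iff {e : B} {v : EB} :
    mder EB EM C.proj e v = 0 ↔ C.form e v ∈ range (lieIncl EG EP P) := by
  constructor
  · intro h
    obtain ⟨U, hU, hx, Φ, hs, ht, h3, h4, h1, h2⟩ := C.locally_trivial (C.proj e)
    have he : e ∈ Φ.source := by rw [hs]; exact hx
    set g := (Φ e).2
    have hΨ : MDAt EB EP (fun e => (Φ e).2) e :=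
      ((contMDiff_snd.comp_contMDiffOn h3).contMDiffAt
        (Φ.open_source.mem_nhds he)).mdifferentiableAt (by simp)
    have hΦ : (C.proj e, g) = Φ e := Prod.ext (h1 e he).symm rfl
    have hsymm : MDifferentiableAt (𝓘(ℝ, EM).prod 𝓘(ℝ, EP)) 𝓘(ℝ, EB)
        (fun a : M × P => Φ.symm (a.1, a.2)) (C.proj e, g) :=
      (h4.contMDiffAt (Φ.open_target.mem_nhds
        (by rw [hΦ]; exact Φ.map_source he))).mdifferentiableAt (by simp)
    have e1 := mder_comp₂ (f := fun x p => Φ.symm (x, p)) hsymm (C.mdAt_proj e) hΨ v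
    have e2 : mder EB EB (fun e => Φ.symm (C.proj e, (Φ e).2)) e v = v := by
      rw [mder_congr (g := fun e => e), mder_id]
      filter_upwards [Φ.open_source.mem_nhds he] with e' he'
      rw [← h1 e' he']
      exact Φ.left_inv he'
    have e3 : (fun p => Φ.symm (C.proj e, p)) = fun p => C.act e (g⁻¹ * p) := by
      funext p
      have ha : C.act e (g⁻¹ * p) ∈ Φ.source := by
        rw [hs] at he ⊢
        exact (congrArg (· ∈ U) (C.proj_act _ _)).mpr he
      rw [← Φ.left_inv ha]
      congr 1
      refine Prod.ext ?_ ?_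
      · rw [h1 _ ha, C.proj_act]
      · rw [h2 _ he]; simp [g]
    rw [e2, h, map_zero, zero_add, e3] at e1
    change v = mder EP EB (fun p => C.act e (g⁻¹ * p)) g _ at e1
    rw [mder_comp (g := fun p => C.act e p) (f := fun p => g⁻¹ * p) (C.mdAt_act_right e _)
      (mdAt_mul_left _ _), inv_mul_cancel] at e1
    rw [e1, form_mder_orbit]
    exact mem_range_self _
  · rintro ⟨w, hw⟩
    rw [← C.form_mder_orbit e] at hw
    rw [← (C.form e).injective hw, proj_mder_orbit]

end CartanGeometry
end Cartan

/-! ### Smoothness of the constant vector fields -/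

section Cartan

variable {EG : Type*} [NormedAddCommGroup EG] [NormedSpace ℝ EG] [CompleteSpace EG]
  {G : Type*} [TopologicalSpace G] [ChartedSpace EG G] [Group G] [LieGroup 𝓘(ℝ, EG) ∞ G]
  {EP : Type*} [NormedAddCommGroup EP] [NormedSpace ℝ EP]
  {P : Subgroup G} [ChartedSpace EP P]
  {EB : Type*} [NormedAddCommGroup EB] [NormedSpace ℝ EB]
  {B : Type*} [TopologicalSpace B] [ChartedSpace EB B] [IsManifold 𝓘(ℝ, EB) ∞ B]
  {EM : Type*} [NormedAddCommGroup EM] [NormedSpace ℝ EM]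
  {M : Type*} [TopologicalSpace M] [ChartedSpace EM M]

namespace CartanGeometry

variable (C : CartanGeometry EG EP EB B EM M P)

/-- The Cartan connection is smooth along smooth curves. -/
lemma contDiffOn_form_velocity {c : ℝ → B} {U : Set ℝ} (hU : IsOpen U)
    (hc : ContMDiffOn 𝓘(ℝ, ℝ) 𝓘(ℝ, EB) ∞ c U) :
    ContDiffOn ℝ ∞ (fun t => C.form (c t) (toModel (velocity c t))) U := by
  have h1 : ContMDiffOn 𝓘(ℝ, ℝ).tangent 𝓘(ℝ, EB).tangent ∞
      (tangentMapWithin 𝓘(ℝ, ℝ) 𝓘(ℝ, EB) c U) (Bundle.TotalSpace.proj ⁻¹' U) :=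
    hc.contMDiffOn_tangentMapWithin (by simp) hU.uniqueMDiffOn
  have h3 := C.smooth_conn.comp_contMDiffOn
    (h1.comp contMDiff_unitField.contMDiffOn (s := U) fun t ht => ht)
  refine (contMDiffOn_iff_contDiffOn.1 h3).congr fun t ht => ?_
  simp only [Function.comp_apply, tangentMapWithin]
  rw [mfderivWithin_of_isOpen hU ht]
  rfl

open Bundle in
/-- The constant vector fields of a Cartan connection are smooth: in a local trivialization of the
tangent bundle they are obtained from the connection by inverting linear maps. -/
lemma contMDiff_constField [FiniteDimensional ℝ EB] (ξ : GroupLieAlgebra 𝓘(ℝ, EG) G) :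
    ContMDiff 𝓘(ℝ, EB) 𝓘(ℝ, EB).tangent ∞
      (fun e => (⟨e, C.constField ξ e⟩ : TangentBundle 𝓘(ℝ, EB) B)) := by
  have : CompleteSpace EB := FiniteDimensional.complete ℝ EB
  intro e₀
  set φ := chartAt EB e₀ with hφ
  set τ := trivializationAt EB (TangentSpace 𝓘(ℝ, EB) : B → Type _) e₀ with hτ
  have hbase : τ.baseSet = φ.source := rfl
  -- the Cartan connection read in the trivialization `τ`
  let A : B → EB →L[ℝ] EG := fun e => (C.form e : EB →L[ℝ] EG).comp (τ.symmL ℝ e : EB →L[ℝ] EB)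
  have hA1 : ∀ v : EB, ContMDiffOn 𝓘(ℝ, EB) 𝓘(ℝ, EG) ∞ (fun e => A e v) φ.source := by
    intro v
    have h1 : ContMDiffOn 𝓘(ℝ, EB) 𝓘(ℝ, EB).tangent ∞
        (fun e => (⟨e, τ.symm e v⟩ : TangentBundle 𝓘(ℝ, EB) B)) τ.baseSet := by
      refine τ.contMDiffOn_section_baseSet_iff.2 ?_
      refine (contMDiffOn_const (c := v)).congr fun e he => ?_
      rw [τ.apply_mk_symm he]
    refine (C.smooth_conn.comp_contMDiffOn h1).congr fun e he => ?_
    exact congrArg (C.form e) (τ.symmL_apply (R := ℝ) he v)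
  have hA2 : ContDiffOn ℝ ∞ (fun y => A (φ.symm y)) φ.target := by
    rw [contDiffOn_clm_apply]
    intro v
    exact ((hA1 v).comp (contMDiffOn_chart_symm (x := e₀)) fun y hy => φ.map_target hy).contDiffOn
  have hA3 : ContMDiffAt 𝓘(ℝ, EB) 𝓘(ℝ, EB →L[ℝ] EG) ∞ A e₀ := by
    have h1 : ContMDiffOn 𝓘(ℝ, EB) 𝓘(ℝ, EB →L[ℝ] EG) ∞ (fun e => A (φ.symm (φ e))) φ.source :=
      hA2.contMDiffOn.comp (contMDiffOn_chart (x := e₀)) fun y hy => φ.map_source hy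
    refine (h1.congr fun e he => ?_).contMDiffAt (φ.open_source.mem_nhds (mem_chart_source EB e₀))
    rw [φ.left_inv he]
  have hA4 : ∀ e (he : e ∈ τ.baseSet),
      A e = (((τ.continuousLinearEquivAt ℝ e he).symm : EB ≃L[ℝ] EB).trans (C.form e) :
        EB →L[ℝ] EG) := by
    intro e he
    ext v
    exact congrArg (C.form e) (congrFun (τ.symm_continuousLinearEquivAt_eq (R := ℝ) he) v).symm
  have he₀ : e₀ ∈ τ.baseSet := mem_chart_source EB e₀
  have hA5 : ContMDiffAt 𝓘(ℝ, EB) 𝓘(ℝ, EB) ∞ (fun e => (A e).inverse ξ) e₀ := by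
    have h1 : ContDiffAt ℝ ∞ (ContinuousLinearMap.inverse : (EB →L[ℝ] EG) → _) (A e₀) := by
      rw [hA4 e₀ he₀]
      exact contDiffAt_map_inverse _
    have h2 := h1.contMDiffAt.comp e₀ hA3
    exact (ContinuousLinearMap.apply ℝ EB (toModel ξ)).contMDiff.contMDiffAt.comp e₀ h2
  rw [Bundle.contMDiffAt_section]
  refine hA5.congr_of_eventuallyEq ?_
  filter_upwards [τ.open_baseSet.mem_nhds he₀] with e he
  rw [hA4 e he, ContinuousLinearMap.inverse_equiv]
  rfl

end CartanGeometry
end Cartan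

/-! ### Homogeneous spaces -/

section Homogeneous

variable {EG : Type*} [NormedAddCommGroup EG] [NormedSpace ℝ EG] [CompleteSpace EG]
  {G : Type*} [TopologicalSpace G] [ChartedSpace EG G] [Group G] [LieGroup 𝓘(ℝ, EG) ∞ G]
  {EX : Type*} [NormedAddCommGroup EX] [NormedSpace ℝ EX]
  {X : Type*} [TopologicalSpace X] [ChartedSpace EX X] [MulAction G X]

variable (G EX) in
/-- The fundamental vector fields of a `G`-manifold, as maps between the model vector spaces. -/
def fund (x : X) : EG →L[ℝ] EX := mder EG EX (fun g : G => g • x) 1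

variable (hX : ContMDiff (𝓘(ℝ, EG).prod 𝓘(ℝ, EX)) 𝓘(ℝ, EX) ∞ (fun a : G × X => a.1 • a.2))
include hX

lemma mdAt_smul₂ (a : G × X) :
    MDifferentiableAt (𝓘(ℝ, EG).prod 𝓘(ℝ, EX)) 𝓘(ℝ, EX) (fun a : G × X => a.1 • a.2) a :=
  hX.contMDiffAt.mdifferentiableAt (by simp)

lemma mdAt_smul_left (g : G) (x : X) : MDAt EX EX (fun x : X => g • x) x :=
  MDAt.comp₂ (f := fun (g : G) (x : X) => g • x) (mdAt_smul₂ hX _) mdifferentiableAt_const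
    mdifferentiableAt_id

lemma mdAt_smul_right (g : G) (x : X) : MDAt EG EX (fun g : G => g • x) g :=
  MDAt.comp₂ (f := fun (g : G) (x : X) => g • x) (mdAt_smul₂ hX _) mdifferentiableAt_id
    mdifferentiableAt_const

/-- The fundamental vector fields are equivariant. -/
lemma mder_smul_fund (g : G) (x : X) (ξ : EG) :
    mder EX EX (fun y : X => g • y) x (fund G EX x ξ) = fund G EX (g • x) (adE g ξ) := by
  have h1 := mder_comp (g := fun y : X => g • y) (f := fun h : G => h • x) (x := 1)
    (mdAt_smul_left hX _ _) (mdAt_smul_right hX _ _) ξ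
  have h2 := mder_comp (g := fun h : G => h • (g • x)) (f := fun h : G => g * h * g⁻¹) (x := 1)
    (mdAt_smul_right hX _ _) ((contMDiff_conj g).contMDiffAt.mdifferentiableAt (by simp)) ξ
  simp only [smul_smul, inv_mul_cancel_right, mul_one, mul_inv_cancel, one_smul] at h1 h2
  rw [fund, ← h1, h2, fund, adE_eq_mder]
  simp only [smul_smul]

/-- The orbit map along a curve in the group, with left logarithmic derivative `ν`. -/
lemma hasVel_smul {q : ℝ → G} {s : ℝ} {ν : EG} (h : HasVel (fun t => (q s)⁻¹ * q t) s ν) (x : X) :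
    HasVel (fun t => q t • x) s (mder EX EX (fun y : X => q s • y) x (fund G EX x ν)) := by
  have h1 := HasVel.comp (f := fun g : G => g • x) (mdAt_smul_right hX _ _) h
  have h2 := HasVel.comp (f := fun y : X => q s • y) (mdAt_smul_left hX _ _) h1
  simpa [smul_smul] using! h2

/-- If the curve `q t • x t` is constant, then the velocity of `x` is the opposite of a fundamental
vector. -/
lemma velocity_eq_neg_fund {q : ℝ → G} {x : ℝ → X} {s : ℝ} {ν : EG} {v : EX}
    (hq : HasVel (fun t => (q s)⁻¹ * q t) s ν) (hx : HasVel x s v)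
    (h : ∀ᶠ t in 𝓝 s, q t • x t = q s • x s) : v = -fund G EX (x s) ν := by
  have h1 := HasVel.comp₂ (f := fun (g : G) (x : X) => g • x) (mdAt_smul₂ hX _) hq hx
  have h2 : HasVel (fun t => ((q s)⁻¹ * q t) • x t) s (0 : EX) := by
    refine (hasVel_const (x s) s).congr ?_
    filter_upwards [h] with t ht
    rw [mul_smul, ht, inv_smul_smul]
  have h3 := h1.unique h2
  simp only [inv_mul_cancel, one_smul, mder_id] at h3
  exact eq_neg_of_add_eq_zero_right h3

end Homogeneous

section Opposite

lemma smul_coset_one {G : Type*} [Group G] {H : Subgroup G} (g : G) :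
    g • ((1 : G) : G ⧸ H) = ((1 : G) : G ⧸ H) ↔ g ∈ H := by
  have : g • ((1 : G) : G ⧸ H) = ((g * 1 : G) : G ⧸ H) := rfl
  rw [this, mul_one, eq_comm, QuotientGroup.eq]
  simp

variable {EG : Type*} [NormedAddCommGroup EG] [NormedSpace ℝ EG] [CompleteSpace EG]
  {G : Type*} [TopologicalSpace G] [ChartedSpace EG G] [Group G] [LieGroup 𝓘(ℝ, EG) ∞ G]
  {EX : Type*} [NormedAddCommGroup EX] [NormedSpace ℝ EX] {H : Subgroup G}
  [ChartedSpace EX (G ⧸ H)] [IsManifold 𝓘(ℝ, EX) ∞ (G ⧸ H)]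

variable (hX : ContMDiff (𝓘(ℝ, EG).prod 𝓘(ℝ, EX)) 𝓘(ℝ, EX) ∞ (fun a : G × (G ⧸ H) => a.1 • a.2))
include hX

/-- The Lie algebra of a closed subgroup `H` is the isotropy algebra of the base point of `G / H`:
the one-parameter subgroup generated by an isotropy vector fixes the base point, as its orbit has
vanishing velocity. -/
lemma fund_coset_one_eq_zero_iff [T2Space G] (ξ : GroupLieAlgebra 𝓘(ℝ, EG) G) :
    fund G EX ((1 : G) : G ⧸ H) (toModel ξ) = 0 ↔ ξ ∈ lieSet (EG := EG) H := by
  constructor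
  · intro h
    obtain ⟨φ, hφ, hadd, h0, hvel⟩ := exists_oneParameterSubgroup (G := G) (toModel ξ)
    have hz : ∀ t ∈ (univ : Set ℝ), HasVel (fun t => φ t • ((1 : G) : G ⧸ H)) t (0 : EX) := by
      intro t _
      have := hasVel_smul hX (hvel t).inv_mul ((1 : G) : G ⧸ H)
      rwa [h, map_zero] at this
    refine ⟨φ, hφ, hadd, fun t => ?_, ?_⟩
    · rw [← smul_coset_one]
      have := eq_of_hasVel_zero isOpen_univ isPreconnected_univ hz (mem_univ t) (mem_univ 0)
      simpa [h0] using this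
    · have h1 := (hvel 0).inv_mul
      simp only [h0, inv_one, one_mul] at h1
      exact h1.2
  · rintro ⟨φ, hφ, hadd, hmem, hv⟩
    have h0 : φ 0 = 1 := by simpa using hadd 0 0
    have h1 : HasVel (fun t => (φ 0)⁻¹ * φ t) 0 (toModel ξ) := by
      simp only [h0, inv_one, one_mul]
      exact ⟨hφ.contMDiffAt.mdifferentiableAt (by simp), hv⟩
    have h2 := velocity_eq_neg_fund hX h1 (hasVel_const ((1 : G) : G ⧸ H) 0)
      (Filter.Eventually.of_forall fun t => by
        rw [(smul_coset_one _).2 (hmem t), (smul_coset_one _).2 (hmem 0)])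
    simpa using h2.symm

end Opposite

/-! ### The decomposition `𝔤 = 𝔤^{<0} ⊕ 𝔭` -/

namespace ParabolicType

variable {EG : Type*} [NormedAddCommGroup EG] [NormedSpace ℝ EG] [CompleteSpace EG]
  {G : Type*} [TopologicalSpace G] [ChartedSpace EG G] [Group G] [LieGroup 𝓘(ℝ, EG) ∞ G]
  {EP : Type*} [NormedAddCommGroup EP] [NormedSpace ℝ EP]
  {P : Subgroup G} [ChartedSpace EP P] (T : ParabolicType EG G EP P)

/-- `𝔤^{<0}`, as a subspace of the model vector space. -/
def negE : Submodule ℝ EG := T.neg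

/-- `𝔭`, as a subspace of the model vector space. -/
def parE : Submodule ℝ EG := T.𝔭.toSubmodule

lemma mem_parE_iff {v : EG} : v ∈ T.parE ↔ v ∈ range (CartanGeometry.lieIncl EG EP P) :=
  Set.ext_iff.1 T.lie_P v

/-- `𝔤 = 𝔤^{<0} ⊕ 𝔭`, as `𝔭` is the part of the grading in nonnegative degrees. -/
lemma isCompl_negE_parE : IsCompl T.negE T.parE := by
  have h0 : T.𝔭.toSubmodule = ⨆ i ≥ (0 : ℤ), T.gr i := T.gr_filt 0
  have h1 : IsCompl T.neg T.𝔭.toSubmodule := by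
    rw [h0]
    constructor
    · refine T.gr_internal.submodule_iSupIndep.disjoint_biSup_biSup
        (s := {i | i < 0}) (t := {i | i ≥ 0}) ?_
      rw [Set.disjoint_left]
      intro i (hi : i < 0) (hi' : i ≥ 0)
      omega
    · rw [codisjoint_iff_le_sup, ← T.gr_internal.submodule_iSup_eq_top]
      refine iSup_le fun i => ?_
      rcases lt_or_ge i 0 with hi | hi
      · exact le_sup_of_le_left (le_iSup₂_of_le i hi le_rfl)
      · exact le_sup_of_le_right (le_iSup₂_of_le i hi le_rfl)
  exact h1

lemma eq_zero_of_mem {v : EG} (h : v ∈ T.negE) (h' : v ∈ T.parE) : v = 0 :=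
  Submodule.disjoint_def.1 T.isCompl_negE_parE.disjoint v h h'

lemma eq_of_sub_mem {v w : EG} (h : v ∈ T.negE) (h' : w ∈ T.negE) (h'' : v - w ∈ T.parE) : v = w :=
  sub_eq_zero.1 (T.eq_zero_of_mem (T.negE.sub_mem h h') h'')

/-- `𝔤^{<0}` lies in the Lie algebra of `P⁻`. -/
lemma mem_lieSet_of_mem_negE {ξ : EG} (h : ξ ∈ T.negE) :
    ξ ∈ lieSet (EG := EG) T.Pm := by
  rw [T.lie_Pm]
  exact (biSup_mono fun i (hi : i < 0) => hi.le : T.neg ≤ ⨆ i ≤ (0 : ℤ), T.gr i) h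

lemma adE_mem_negE {p : G} (hp : p ∈ T.P0) {v : EG} (h : v ∈ T.negE) : adE p v ∈ T.negE := by
  have : T.neg ≤ T.neg.comap (Ad (EG := EG) p : _ →ₗ[ℝ] _) := by
    refine iSup₂_le fun i hi v hv => ?_
    exact (le_iSup₂_of_le (f := fun i (_ : i < (0 : ℤ)) => T.gr i) i hi le_rfl) ((hp.2 i v).2 hv)
  exact this h

/-- The hypothesis `P ∩ P⁻ = P⁰`, elementwise. -/
lemma mem_P0_iff {p : G} : p ∈ T.P0 ↔ p ∈ P ∧ p ∈ T.Pm := by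
  have := T.inf_eq
  rw [P0, ← this, Subgroup.mem_inf]

include T in
lemma mdAt_incl (p : P) : MDAt EP EG (fun p : P => (p : G)) p :=
  T.embedded.contMDiff.mdifferentiable (by simp) p

include T in
/-- Left logarithmic derivatives of curves in `P`, seen in `𝔤`. -/
lemma hasVel_incl {q : ℝ → P} {s : ℝ} {ν : EP} (h : HasVel (fun t => (q s)⁻¹ * q t) s ν) :
    HasVel (fun t => (q s : G)⁻¹ * q t) s (CartanGeometry.lieIncl EG EP P ν) := by
  have h1 := HasVel.comp (f := fun p : P => (p : G)) (T.mdAt_incl _) h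
  simp only [inv_mul_cancel] at h1
  exact h1

variable [LieGroup 𝓘(ℝ, EP) ∞ P]

/-- `𝔭` is invariant under `P`, since conjugation by an element of `P` restricts to `P`. -/
lemma adE_mem_parE (p : P) {v : EG} (h : v ∈ T.parE) : adE (p : G) v ∈ T.parE := by
  rw [mem_parE_iff] at h ⊢
  obtain ⟨w, rfl⟩ := h
  refine ⟨mder EP EP (fun x : P => p * x * p⁻¹) 1 w, ?_⟩
  have hc : MDAt EP EP (fun x : P => p * x * p⁻¹) 1 :=
    (contMDiff_conj p).contMDiffAt.mdifferentiableAt (by simp)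
  have h1 := mder_comp (g := fun x : P => (x : G)) (f := fun x : P => p * x * p⁻¹) (x := 1)
    (T.mdAt_incl _) hc w
  have h2 := mder_comp (g := fun x : G => (p : G) * x * (p : G)⁻¹) (f := fun x : P => (x : G))
    (x := 1) ((contMDiff_conj (p : G)).contMDiffAt.mdifferentiableAt (by simp)) (T.mdAt_incl _) w
  simp only [mul_one, mul_inv_cancel] at h1
  exact h1.symm.trans h2

variable [FiniteDimensional ℝ EG]

/-- The projection of `𝔤` onto `𝔤^{<0}` along `𝔭`. -/
def projNeg : EG →L[ℝ] EG :=
  (T.negE.subtype ∘ₗ T.negE.projectionOnto T.parE T.isCompl_negE_parE).toContinuousLinearMap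

lemma projNeg_mem (v : EG) : T.projNeg v ∈ T.negE := by
  simp [projNeg]

lemma projNeg_eq_zero {v : EG} (h : v ∈ T.parE) : T.projNeg v = 0 := by
  have := (Submodule.projectionOnto_apply_eq_zero_iff T.isCompl_negE_parE).2 h
  simp [projNeg, this]

lemma projNeg_eq_self {v : EG} (h : v ∈ T.negE) : T.projNeg v = v := by
  have := Submodule.projectionOnto_apply_left T.isCompl_negE_parE ⟨v, h⟩
  simp [projNeg, this]

lemma sub_projNeg_mem (v : EG) : v - T.projNeg v ∈ T.parE := by
  obtain ⟨a, b, ha, hb, hab⟩ : ∃ a b, a ∈ T.negE ∧ b ∈ T.parE ∧ a + b = v := by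
    have := T.isCompl_negE_parE.sup_eq_top ▸ Submodule.mem_top (x := v)
    obtain ⟨a, ha, b, hb, h⟩ := Submodule.mem_sup.1 this
    exact ⟨a, b, ha, hb, h⟩
  rw [← hab, map_add, T.projNeg_eq_self ha, T.projNeg_eq_zero hb, add_zero, add_sub_cancel_left]
  exact hb

/-- A linear section of the inclusion `Lie P → 𝔭`. -/
lemma exists_lieIncl_section :
    ∃ S : EG →L[ℝ] EP, ∀ v ∈ T.parE, CartanGeometry.lieIncl EG EP P (S v) = v := by
  let ι : EP →ₗ[ℝ] EG := (CartanGeometry.lieIncl EG EP P : EP →L[ℝ] EG)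
  obtain ⟨g, hg⟩ := ι.rangeRestrict.exists_rightInverse_of_surjective ι.range_rangeRestrict
  obtain ⟨S, hS⟩ := LinearMap.exists_extend g
  refine ⟨S.toContinuousLinearMap, fun v hv => ?_⟩
  have hv' : v ∈ LinearMap.range ι := T.mem_parE_iff.1 hv
  have h1 : S v = g ⟨v, hv'⟩ := LinearMap.congr_fun hS ⟨v, hv'⟩
  have h2 := LinearMap.congr_fun hg ⟨v, hv'⟩
  have h3 : ι (S v) = v := by
    rw [h1]
    exact congrArg Subtype.val h2
  exact h3

end ParabolicType

/-! ### Parabolic geodesics and the Weyl structures they determine -/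

section Geodesics

variable {EG : Type*} [NormedAddCommGroup EG] [NormedSpace ℝ EG] [CompleteSpace EG]
  {G : Type*} [TopologicalSpace G] [ChartedSpace EG G] [Group G] [LieGroup 𝓘(ℝ, EG) ∞ G]
  {EP : Type*} [NormedAddCommGroup EP] [NormedSpace ℝ EP]
  {P : Subgroup G} [ChartedSpace EP P] [LieGroup 𝓘(ℝ, EP) ∞ P]
  {EB : Type*} [NormedAddCommGroup EB] [NormedSpace ℝ EB]
  {B : Type*} [TopologicalSpace B] [ChartedSpace EB B] [IsManifold 𝓘(ℝ, EB) ∞ B]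
  {EM : Type*} [NormedAddCommGroup EM] [NormedSpace ℝ EM]
  {M : Type*} [TopologicalSpace M] [ChartedSpace EM M]

namespace CartanGeometry

variable (C : CartanGeometry EG EP EB B EM M P) (T : ParabolicType EG G EP P)

/-- The map `ξ ↦ π_* (ω_e⁻¹ ξ)`, between the model vector spaces. -/
def anchor (e : B) : EG →L[ℝ] EM :=
  (mder EB EM C.proj e).comp ((C.form e).symm : EG →L[ℝ] EB)

lemma toModel_toTangent (e : B) (ξ : GroupLieAlgebra 𝓘(ℝ, EG) G) :
    toModel (C.toTangent e ξ) = C.anchor e (toModel ξ) := rfl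

lemma anchor_form (e : B) (v : EB) : C.anchor e (C.form e v) = mder EB EM C.proj e v := by
  simp [anchor]

lemma anchor_eq_zero_iff {e : B} {v : EG} : C.anchor e v = 0 ↔ v ∈ T.parE := by
  have := C.mder_proj_eq_zero_iff (e := e) (v := (C.form e).symm v)
  rw [(C.form e).apply_symm_apply, ← T.mem_parE_iff] at this
  exact this

lemma anchor_act (e : B) (p : P) (v : EG) :
    C.anchor (C.act e p) v = C.anchor e (adE (p : G) v) := by
  have h1 := C.proj_mder_act e p ((C.form e).symm (adE (p : G) v))
  rw [← C.anchor_form, C.form_mder_act, (C.form e).apply_symm_apply, adE_inv_adE] at h1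
  exact h1

lemma hasVel_proj {c : ℝ → B} {s : ℝ} {v : EB} (h : HasVel c s v) {γ : ℝ → M}
    (hγ : ∀ᶠ t in 𝓝 s, C.proj (c t) = γ t) : HasVel γ s (C.anchor (c s) (C.form (c s) v)) := by
  rw [anchor_form]
  exact (HasVel.comp (C.mdAt_proj _) h).congr (by filter_upwards [hγ] with t ht using ht.symm)

/-- The velocities of two lifts of the same curve differ by a vertical vector at a common point. -/
lemma form_sub_form_mem {c d : ℝ → B} {s : ℝ} {v w : EB} (hc : HasVel c s v) (hd : HasVel d s w)
    {γ : ℝ → M} (h : ∀ᶠ t in 𝓝 s, C.proj (c t) = γ t) (h' : ∀ᶠ t in 𝓝 s, C.proj (d t) = γ t)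
    (e : c s = d s) : C.form (c s) v - C.form (d s) w ∈ T.parE := by
  rw [← C.anchor_eq_zero_iff T (e := c s), map_sub, sub_eq_zero, (C.hasVel_proj hc h).unique
    (C.hasVel_proj hd h'), e]

/-- Translating an integral curve of a constant vector field by an element of `P`. -/
lemma hasVel_act_const {c : ℝ → B} {s : ℝ} {ξ : EG} (h : HasVel c s ((C.form (c s)).symm ξ))
    (p : P) : HasVel (fun t => C.act (c t) p) s
      ((C.form (C.act (c s) p)).symm (adE (p : G)⁻¹ ξ)) := by
  have h1 := HasVel.comp (C.mdAt_act_left p _) h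
  have h2 := C.form_mder_act (c s) p ((C.form (c s)).symm ξ)
  rw [(C.form _).apply_symm_apply] at h2
  rwa [← h2, (C.form _).symm_apply_apply]

lemma isMIntegralCurveOn_constField_iff {c : ℝ → B} {I : Set ℝ} (hI : IsOpen I) {ξ : EG} :
    IsMIntegralCurveOn c (C.constField (G := G) ξ) I ↔
      ∀ t ∈ I, HasVel c t ((C.form (c t)).symm ξ) :=
  isMIntegralCurveOn_iff_hasVel hI

/-- After translation by an element of `P`, the generator of a parabolic geodesic is
in `𝔤^{<0}`. -/
lemma isParabolicGeodesic_iff {γ : ℝ → M} {I : Set ℝ} (hI : IsOpen I) :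
    C.IsParabolicGeodesic T γ I ↔ ∃ ξ ∈ T.negE, ξ ≠ 0 ∧ ∃ c : ℝ → B,
      (∀ t ∈ I, HasVel c t ((C.form (c t)).symm ξ)) ∧ ∀ t ∈ I, C.proj (c t) = γ t := by
  constructor
  · rintro ⟨ξ, ⟨h0, p, hp, hξ⟩, c, hc, hγ⟩
    have hc' := (C.isMIntegralCurveOn_constField_iff hI (ξ := ξ)).1 hc
    refine ⟨adE p⁻¹ ξ, hξ, fun h => h0 ?_, fun t => C.act (c t) ⟨p, hp⟩, fun t ht =>
      C.hasVel_act_const (hc' t ht) ⟨p, hp⟩, fun t ht => by rw [C.proj_act, hγ t ht]⟩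
    exact (adE_adE_inv p (toModel ξ)).symm.trans ((congrArg (adE p) h).trans (map_zero _))
  · rintro ⟨ξ, hξ, h0, c, hc, hγ⟩
    refine ⟨ξ, ⟨h0, 1, P.one_mem, ?_⟩, c, (C.isMIntegralCurveOn_constField_iff hI).2 hc, hγ⟩
    change adE (1 : G)⁻¹ ξ ∈ T.negE
    rwa [inv_one, adE_one]

variable {T}

/-- The Weyl structure along `γ` given by the `P⁰`-orbits of the points of a smooth lift of `γ`. -/
def weylOfLift {γ : ℝ → M} {I : Set ℝ} (hI : IsOpen I) {c : ℝ → B}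
    (hc : ContMDiffOn 𝓘(ℝ, ℝ) 𝓘(ℝ, EB) ∞ c I) (hγ : ∀ t ∈ I, C.proj (c t) = γ t) :
    WeylAlong C T γ I where
  carrier s := {e | ∃ p : P, (p : G) ∈ T.P0 ∧ e = C.act (c s) p}
  proj_eq := by
    rintro s hs _ ⟨p, -, rfl⟩
    rw [C.proj_act, hγ s hs]
  orbit := by
    rintro s hs _ ⟨p, hp, rfl⟩ e'
    constructor
    · rintro ⟨q, hq, rfl⟩
      refine ⟨p⁻¹ * q, ?_, by rw [← C.act_mul, mul_inv_cancel_left]⟩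
      simpa using T.P0.mul_mem (T.P0.inv_mem hp) hq
    · rintro ⟨q, hq, rfl⟩
      exact ⟨p * q, by simpa using T.P0.mul_mem hp hq, by rw [C.act_mul]⟩
  smooth s hs := ⟨I, hI, hs, Subset.rfl, c, hc, fun t ht =>
    ⟨1, T.P0.one_mem, (C.act_one _).symm⟩⟩

lemma mem_weylOfLift {γ : ℝ → M} {I : Set ℝ} (hI : IsOpen I) {c : ℝ → B}
    (hc : ContMDiffOn 𝓘(ℝ, ℝ) 𝓘(ℝ, EB) ∞ c I) (hγ : ∀ t ∈ I, C.proj (c t) = γ t) (t : ℝ) :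
    c t ∈ (C.weylOfLift (T := T) hI hc hγ).carrier t :=
  ⟨1, T.P0.one_mem, (C.act_one _).symm⟩

section Lift

variable {γ : ℝ → M} {I : Set ℝ} (hI : IsOpen I) {c : ℝ → B}
    (hs : ContMDiffOn 𝓘(ℝ, ℝ) 𝓘(ℝ, EB) ∞ c I) (hγ : ∀ t ∈ I, C.proj (c t) = γ t)
    {ξ : EG} (hξ : ξ ∈ T.negE) (hc : ∀ t ∈ I, HasVel c t ((C.form (c t)).symm ξ))

include hξ hc in
/-- The projection of an integral curve of `ω⁻¹(ξ)`, with `ξ ∈ 𝔤^{<0}`, is a geodesic of the Weyl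
connection that the curve determines: the curve is horizontal, and the coordinates `ξ` of the
velocity are constant. -/
lemma isGeodesic_weylOfLift : (C.weylOfLift (T := T) hI hs hγ).IsGeodesic := by
  intro s hs'
  let ζ : GroupLieAlgebra 𝓘(ℝ, EG) G := ξ
  -- the lift is `c` itself: its velocity is horizontal, so the connection form vanishes on it
  refine ⟨I, hI, hs', Subset.rfl, c, fun _ => ζ, hs, contDiffOn_const, hγ, fun t ht => ?_,
    (0 : EG), ⟨T.𝔭.zero_mem, ?_⟩, ?_⟩
  · have h1 := C.hasVel_proj (hc t ht) (γ := γ) (Filter.eventually_of_mem (hI.mem_nhds ht) hγ)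
    rw [(C.form _).apply_symm_apply] at h1
    exact h1.velocity_eq
  · refine ⟨c s, C.mem_weylOfLift hI hs hγ s, 1, C.act_one _, ξ, hξ, ?_⟩
    have h1 : toModel (velocity c s) - (C.form (c s)).symm 0 = (C.form (c s)).symm ξ := by
      rw [map_zero, sub_zero]
      exact (hc s hs').velocity_eq
    refine h1.trans ?_
    have h2 := mder_id (c s) ((C.form (c s)).symm ξ)
    have h3 : (fun e => C.act e 1) = fun e => e := by
      funext e
      exact C.act_one e
    rw [← h3] at h2
    exact h2.symm
  · have h1 : deriv (fun _ => ζ) s + ⁅(0 : GroupLieAlgebra 𝓘(ℝ, EG) G), ζ⁆ = 0 := by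
      rw [zero_lie, add_zero]
      exact deriv_const s (ξ : EG)
    refine Eq.symm ?_
    refine (C.toModel_toTangent (c s) _).trans ?_
    refine (congrArg (fun v : EG => C.anchor (c s) v) h1).trans (map_zero _)

include hξ hc in
/-- The Weyl structure determined by an integral curve of `ω⁻¹(ξ)`, with `ξ ∈ 𝔤^{<0}`, is parallel,
since the isotropy algebra of the base point of `G / P⁻` contains `ξ`. -/
lemma isParallel_weylOfLift {EX : Type*} [NormedAddCommGroup EX] [NormedSpace ℝ EX]
    [ChartedSpace EX (G ⧸ T.Pm)] [IsManifold 𝓘(ℝ, EX) ∞ (G ⧸ T.Pm)] [T2Space G]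
    (hX : ContMDiff (𝓘(ℝ, EG).prod 𝓘(ℝ, EX)) 𝓘(ℝ, EX) ∞
      (fun a : G × (G ⧸ T.Pm) => a.1 • a.2)) :
    (C.weylOfLift (T := T) hI hs hγ).IsParallel EX := by
  intro s hs'
  refine ⟨I, hI, hs', Subset.rfl, c, fun _ => ((1 : G) : G ⧸ T.Pm), hs, contMDiffOn_const,
    fun t _ => ?_, fun t ht => ⟨ξ, ?_⟩⟩
  · exact congrArg (C.weylToMoebius T)
      (WeylAlong.toSection_eq _ t (C.mem_weylOfLift hI hs hγ t))
  · have h1 : toModel (velocity c t) = (C.form (c t)).symm ξ := (hc t ht).velocity_eq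
    have h2 : toModel (velocity (E := EX) (fun _ : ℝ => ((1 : G) : G ⧸ T.Pm)) t) = 0 :=
      (hasVel_const _ t).velocity_eq
    have h3 : fund G EX ((1 : G) : G ⧸ T.Pm) ξ = 0 :=
      (fund_coset_one_eq_zero_iff hX ξ).2 (T.mem_lieSet_of_mem_negE hξ)
    refine Prod.ext h1.symm ?_
    refine Eq.trans ?_ h2.symm
    exact (congrArg Neg.neg h3).trans neg_zero

end Lift

end CartanGeometry

end Geodesics

/-! ### Integral curves in a Weyl structure, near a given time -/

section Converse

variable {EG : Type*} [NormedAddCommGroup EG] [NormedSpace ℝ EG] [CompleteSpace EG]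
  {G : Type*} [TopologicalSpace G] [ChartedSpace EG G] [Group G] [LieGroup 𝓘(ℝ, EG) ∞ G]
  {EP : Type*} [NormedAddCommGroup EP] [NormedSpace ℝ EP]
  {P : Subgroup G} [ChartedSpace EP P] [LieGroup 𝓘(ℝ, EP) ∞ P]
  {EB : Type*} [NormedAddCommGroup EB] [NormedSpace ℝ EB]
  {B : Type*} [TopologicalSpace B] [ChartedSpace EB B] [IsManifold 𝓘(ℝ, EB) ∞ B]
  {EM : Type*} [NormedAddCommGroup EM] [NormedSpace ℝ EM]
  {M : Type*} [TopologicalSpace M] [ChartedSpace EM M]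

namespace CartanGeometry.WeylAlong

variable {C : CartanGeometry EG EP EB B EM M P} {T : ParabolicType EG G EP P}
  {γ : ℝ → M} {I : Set ℝ} (σ : WeylAlong C T γ I)

include σ in
lemma eventually_mem {s : ℝ} (hs : s ∈ I) : ∀ᶠ t in 𝓝 s, t ∈ I := by
  obtain ⟨U, hU, hsU, hUI, -⟩ := σ.smooth s hs
  exact Filter.mem_of_superset (hU.mem_nhds hsU) hUI

lemma eventually_proj {s : ℝ} (hs : s ∈ I) {c : ℝ → B} (h : ∀ᶠ t in 𝓝 s, c t ∈ σ.carrier t) :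
    ∀ᶠ t in 𝓝 s, C.proj (c t) = γ t := by
  filter_upwards [h, σ.eventually_mem hs] with t ht ht' using σ.proj_eq t ht' _ ht

/-- The Cartan connection maps the velocities of sections of a parallel Weyl structure into the
isotropy algebra of the base point of `G / P⁻`. -/
lemma fund_form_eq_zero {EX : Type*} [NormedAddCommGroup EX] [NormedSpace ℝ EX]
    [ChartedSpace EX (G ⧸ T.Pm)] [IsManifold 𝓘(ℝ, EX) ∞ (G ⧸ T.Pm)]
    (hX : ContMDiff (𝓘(ℝ, EG).prod 𝓘(ℝ, EX)) 𝓘(ℝ, EX) ∞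
      (fun a : G × (G ⧸ T.Pm) => a.1 • a.2))
    (hpar : σ.IsParallel EX) {s : ℝ} (hs : s ∈ I) {r : ℝ → B} {v : EB} (hv : HasVel r s v)
    (hr : ∀ᶠ t in 𝓝 s, r t ∈ σ.carrier t) :
    fund G EX ((1 : G) : G ⧸ T.Pm) (C.form (r s) v) = 0 := by
  obtain ⟨U, hU, hsU, hUI, c, x, hc, hx, hcls, hhor⟩ := hpar s hs
  have hc1 : MDAt ℝ EB c s := (hc.contMDiffAt (hU.mem_nhds hsU)).mdifferentiableAt (by simp)
  have hx1 : MDAt ℝ EX x s := (hx.contMDiffAt (hU.mem_nhds hsU)).mdifferentiableAt (by simp)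
  -- both pairs `(r t, o)` and `(c t, x t)` represent the section
  have hrel : ∀ᶠ t in 𝓝 s, ∃ p : P, c t = C.act (r t) p ∧
      x t = (p : G)⁻¹ • ((1 : G) : G ⧸ T.Pm) := by
    filter_upwards [hr, hU.mem_nhds hsU] with t ht htU
    have h1 := hcls ⟨t, hUI htU⟩ htU
    have h2 := congrArg (C.weylToMoebius T) (σ.toSection_eq ⟨t, hUI htU⟩ ht)
    have h3 : C.cls (r t) ((1 : G) : G ⧸ T.Pm) = C.cls (c t) (x t) := h2.symm.trans h1
    obtain ⟨p, hp⟩ := Quotient.exact (s := C.assocSetoid _) h3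
    exact ⟨p, congrArg Prod.fst hp, congrArg Prod.snd hp⟩
  obtain ⟨q, hq, hqt⟩ := C.exists_act_curve hv.1 hc1 (by
    filter_upwards [hrel] with t ⟨p, hp, _⟩
    rw [hp, C.proj_act])
  have hqx : ∀ᶠ t in 𝓝 s, (q t : G) • x t = ((1 : G) : G ⧸ T.Pm) := by
    filter_upwards [hrel, hqt] with t ⟨p, hp, hpx⟩ h2
    rw [C.act_injective (h2.symm.trans hp), hpx, smul_inv_smul]
  obtain ⟨ν, hν⟩ := hq.exists_hasVel_inv_mul
  have h1 := velocity_eq_neg_fund hX (q := fun t => (q t : G)) (T.hasVel_incl hν) hx1.hasVel (by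
    filter_upwards [hqx] with t ht
    rw [ht, hqx.self_of_nhds])
  obtain ⟨z, hz, hzf⟩ := C.hasVel_act hv hν
  have hz' := hz.congr hqt
  obtain ⟨ξ, hξ⟩ := hhor s hsU
  have h2 : (C.form (c s)).symm (toModel ξ) = z :=
    (congrArg Prod.fst hξ).trans hz'.velocity_eq
  have h3 : -fund G EX (x s) (toModel ξ) = toModel (velocity x s) := congrArg Prod.snd hξ
  have h4 : toModel ξ = adE (q s : G)⁻¹ (C.form (r s) v) + lieIncl EG EP P ν := by
    rw [← hzf, ← h2, ← hqt.self_of_nhds, (C.form _).apply_symm_apply]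
  rw [h1, h4, map_add, neg_inj, add_eq_right] at h3
  have h5 := mder_smul_fund hX (q s : G) (x s) (adE (q s : G)⁻¹ (C.form (r s) v))
  rwa [h3, map_zero, adE_adE_inv, hqx.self_of_nhds, eq_comm] at h5

/-- Near any time, a parallel Weyl structure has a section that is horizontal for its Weyl
connection: a smooth section of the reduction is corrected by the solution of a linear equation in
`P`, which stays in `P⁻` because its orbit in `G / P⁻` has vanishing velocity. -/
lemma exists_horizontal_section [FiniteDimensional ℝ EG] [CompleteSpace EP] {EX : Type*}
    [NormedAddCommGroup EX] [NormedSpace ℝ EX]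
    [ChartedSpace EX (G ⧸ T.Pm)] [IsManifold 𝓘(ℝ, EX) ∞ (G ⧸ T.Pm)] [T2Space G]
    (hX : ContMDiff (𝓘(ℝ, EG).prod 𝓘(ℝ, EX)) 𝓘(ℝ, EX) ∞
      (fun a : G × (G ⧸ T.Pm) => a.1 • a.2))
    (hpar : σ.IsParallel EX) {s : ℝ} (hs : s ∈ I) :
    ∃ (c : ℝ → B) (z : ℝ → EB), ∀ᶠ t in 𝓝 s, c t ∈ σ.carrier t ∧ HasVel c t (z t) ∧
      C.form (c t) (z t) ∈ T.negE := by
  obtain ⟨U, hU, hsU, hUI, r, hr, hrc⟩ := σ.smooth s hs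
  have hrv : ∀ t ∈ U, HasVel r t (toModel (velocity r t)) := fun t ht =>
    MDAt.hasVel ((hr.contMDiffAt (hU.mem_nhds ht)).mdifferentiableAt (by simp))
  set u : ℝ → EG := fun t => C.form (r t) (toModel (velocity r t)) with hu
  have hus : ContDiffOn ℝ ∞ u U := C.contDiffOn_form_velocity hU hr
  obtain ⟨S, hS⟩ := T.exists_lieIncl_section
  -- the component of `u` in `𝔭`, seen in the Lie algebra of `P`
  set w : ℝ → EP := fun t => S (u t - T.projNeg (u t)) with hw
  have hws : ContDiffAt ℝ ∞ w s :=
    S.contDiff.contDiffAt.comp s ((hus.contDiffAt (hU.mem_nhds hsU)).sub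
      (T.projNeg.contDiff.contDiffAt.comp s (hus.contDiffAt (hU.mem_nhds hsU))))
  have hwu : ∀ t, lieIncl EG EP P (w t) = u t - T.projNeg (u t) := fun t =>
    hS _ (T.sub_projNeg_mem _)
  have hw0 : ∀ t ∈ U, fund G EX ((1 : G) : G ⧸ T.Pm) (lieIncl EG EP P (w t)) = 0 := by
    intro t ht
    have hn : fund G EX ((1 : G) : G ⧸ T.Pm) (T.projNeg (u t)) = 0 :=
      (fund_coset_one_eq_zero_iff hX _).2 (T.mem_lieSet_of_mem_negE (T.projNeg_mem _))
    rw [hwu, map_sub, σ.fund_form_eq_zero hX hpar (hUI ht) (hrv t ht)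
      (Filter.eventually_of_mem (hU.mem_nhds ht) hrc), hn, sub_zero]
  obtain ⟨a, ha0, ha⟩ := exists_hasVel_leftField (G := P) hws
  have hav : ∀ᶠ t in 𝓝 s, HasVel (fun t => (a t : G) • ((1 : G) : G ⧸ T.Pm)) t (0 : EX) := by
    filter_upwards [ha, hU.mem_nhds hsU] with t ht htU
    have := hasVel_smul hX (q := fun t => (a t : G)) (T.hasVel_incl ht.inv_mul)
      ((1 : G) : G ⧸ T.Pm)
    rwa [hw0 t htU, map_zero] at this
  have haP : ∀ᶠ t in 𝓝 s, (a t : G) ∈ T.P0 := by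
    filter_upwards [eventually_eq_of_hasVel_zero hav] with t ht
    refine T.mem_P0_iff.2 ⟨(a t).2, ?_⟩
    rw [← smul_coset_one, ht, ha0]
    simp
  have hcv : ∀ᶠ t in 𝓝 s, MDAt ℝ EB (fun t => C.act (r t) (a t)⁻¹) t := by
    filter_upwards [ha, hU.mem_nhds hsU] with t ht htU
    exact MDAt.comp₂ (C.mdAt_act₂ _) (hrv t htU).1 (MDAt.comp (g := fun p : P => p⁻¹)
      ((contMDiff_inv 𝓘(ℝ, EP) ∞).mdifferentiable (by simp) _) ht.1)
  refine ⟨fun t => C.act (r t) (a t)⁻¹, fun t =>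
    toModel (velocity (fun t => C.act (r t) (a t)⁻¹) t), ?_⟩
  filter_upwards [ha, haP, hcv, hU.mem_nhds hsU] with t h1 h2 h3 htU
  refine ⟨(σ.orbit t (hUI htU) _ (hrc t htU) _).2 ⟨(a t)⁻¹, T.P0.inv_mem h2, rfl⟩, h3.hasVel, ?_⟩
  obtain ⟨z, hz, hzf⟩ := C.hasVel_act h3.hasVel h1.inv_mul
  simp only [← C.act_mul, inv_mul_cancel, C.act_one] at hz hzf
  have h4 : adE (a t : G)⁻¹ (C.form (C.act (r t) (a t)⁻¹)
      (toModel (velocity (fun t => C.act (r t) (a t)⁻¹) t))) = T.projNeg (u t) := by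
    rw [hz.unique (hrv t htU), hwu] at hzf
    rw [eq_comm, ← eq_sub_iff_add_eq] at hzf
    rw [hzf]
    exact sub_sub_cancel _ _
  rw [← adE_adE_inv (a t : G) (C.form _ _), h4]
  exact T.adE_mem_negE h2 (T.projNeg_mem _)

/-- Along a horizontal section of the reduction, the coordinates of the velocity of a geodesic have
vanishing derivative. -/
lemma hasDerivAt_form_zero [FiniteDimensional ℝ EG] {s : ℝ} (hs : s ∈ I)
    (hgeo : σ.HasWeylDeriv (fun t => velocity γ t) s 0) {c : ℝ → B} {z : ℝ → EB}
    (h : ∀ᶠ t in 𝓝 s, c t ∈ σ.carrier t ∧ HasVel c t (z t) ∧ C.form (c t) (z t) ∈ T.negE) :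
    HasDerivAt (fun t => C.form (c t) (z t)) 0 s := by
  obtain ⟨U, hU, hsU, hUI, d, f, hd, hf, hdγ, hY, η, ⟨hη, hhor⟩, hZ⟩ := hgeo
  have hcγ := σ.eventually_proj hs (h.mono fun t ht => ht.1)
  obtain ⟨hcs, hcv, hcn⟩ := h.self_of_nhds
  have hd1 : MDAt ℝ EB d s := (hd.contMDiffAt (hU.mem_nhds hsU)).mdifferentiableAt (by simp)
  have hf1 : HasDerivAt (fun t => toModel (f t)) (toModel (deriv f s)) s :=
    ((hf.contDiffAt (hU.mem_nhds hsU)).differentiableAt (by simp)).hasDerivAt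
  obtain ⟨q, hq, hqt⟩ := C.exists_act_curve hcv.1 hd1 (by
    filter_upwards [hcγ, hU.mem_nhds hsU] with t h1 h2
    rw [h1, hdγ t h2])
  obtain ⟨ν, hν⟩ := hq.exists_hasVel_inv_mul
  have hds := hqt.self_of_nhds
  -- the value `η` of the connection form is the logarithmic derivative of `q`
  obtain ⟨y, hy, hyf⟩ := C.hasVel_act hcv hν
  replace hy := hy.congr hqt
  rw [← hds] at hyf
  have hην : toModel η = lieIncl EG EP P ν := by
    obtain ⟨r, hr, p, hrp, ξ, hξ, hv⟩ := hhor
    obtain ⟨p₀, hp₀, rfl⟩ := (σ.orbit s hs _ hcs _).1 hr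
    have h1 : p₀ * p = q s := C.act_injective (e := c s) (by rw [C.act_mul, hrp, hds])
    have h2 : C.form (d s) (toModel (velocity d s) - (C.form (d s)).symm (toModel η)) =
        adE (p : G)⁻¹ (toModel ξ) := by
      have h3 := C.form_mder_act (C.act (c s) p₀) p
        ((C.form (C.act (c s) p₀)).symm (toModel ξ))
      rw [(C.form _).apply_symm_apply, hrp] at h3
      rw [← h3]
      exact congrArg (C.form (d s)) hv
    rw [map_sub, (C.form _).apply_symm_apply, hy.velocity_eq, hyf] at h2
    have h4 := congrArg (adE (q s : G)) h2
    rw [map_sub, map_add, adE_adE_inv] at h4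
    have h5 : adE (q s : G) (adE (p : G)⁻¹ (toModel ξ)) = adE (p₀ : G) (toModel ξ) := by
      rw [← h1, Subgroup.coe_mul, adE_mul, adE_adE_inv]
    rw [h5, add_sub_assoc, ← map_sub] at h4
    have hνp : lieIncl EG EP P ν - toModel η ∈ T.parE :=
      T.parE.sub_mem (T.mem_parE_iff.2 (mem_range_self _)) hη
    have h6 : C.form (c s) (z s) = adE (p₀ : G) (toModel ξ) := by
      refine T.eq_of_sub_mem hcn (T.adE_mem_negE hp₀ hξ) ?_
      rw [← h4, sub_add_cancel_left]
      exact T.parE.neg_mem (T.adE_mem_parE (q s) hνp)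
    rw [h6, add_eq_left] at h4
    have h7 := congrArg (adE (q s : G)⁻¹) h4
    rw [adE_inv_adE, map_zero, sub_eq_zero] at h7
    exact h7.symm
  have hpar : toModel (deriv f s) + toModel ⁅η, f s⁆ ∈ T.parE := by
    rw [← C.anchor_eq_zero_iff T (e := d s)]
    exact hZ.symm
  -- the coordinates of `γ'` along `c` are obtained from those along `d`
  have hform : ∀ᶠ t in 𝓝 s,
      C.form (c t) (z t) = T.projNeg (adE (q t : G) (toModel (f t))) := by
    filter_upwards [h, hcγ.eventually_nhds, hqt, hU.mem_nhds hsU] with t h1 h2 h3 htU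
    have h4 := (C.hasVel_proj h1.2.1 h2).velocity_eq
    have h5 : toModel (velocity γ t) = C.anchor (d t) (toModel (f t)) := hY t htU
    rw [h5, h3, C.anchor_act, ← sub_eq_zero, ← map_sub, C.anchor_eq_zero_iff T] at h4
    have h6 := T.projNeg_eq_zero h4
    rw [map_sub, sub_eq_zero, T.projNeg_eq_self h1.2.2] at h6
    exact h6.symm
  have hder := hasDerivAt_adE_apply (q := fun t => (q t : G)) (ν := η) (by
    rw [hην]; exact T.hasVel_incl hν) hf1
  have h8 := T.projNeg.hasFDerivAt.comp_hasDerivAt s hder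
  rw [T.projNeg_eq_zero (T.adE_mem_parE (q s) hpar)] at h8
  exact h8.congr_of_eventuallyEq hform

/-- Near any time, a Weyl structure as in the theorem contains an integral curve of a constant
vector field `ω⁻¹(ξ)` with `ξ ∈ 𝔤^{<0}`. -/
lemma exists_integral_section [FiniteDimensional ℝ EG] [CompleteSpace EP] {EX : Type*}
    [NormedAddCommGroup EX] [NormedSpace ℝ EX]
    [ChartedSpace EX (G ⧸ T.Pm)] [IsManifold 𝓘(ℝ, EX) ∞ (G ⧸ T.Pm)] [T2Space G]
    (hX : ContMDiff (𝓘(ℝ, EG).prod 𝓘(ℝ, EX)) 𝓘(ℝ, EX) ∞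
      (fun a : G × (G ⧸ T.Pm) => a.1 • a.2))
    (hgeo : σ.IsGeodesic) (hpar : σ.IsParallel EX) {s : ℝ} (hs : s ∈ I) :
    ∃ ξ ∈ T.negE, ∃ c : ℝ → B, ∀ᶠ t in 𝓝 s, c t ∈ σ.carrier t ∧
      HasVel c t ((C.form (c t)).symm ξ) := by
  obtain ⟨c, z, h⟩ := σ.exists_horizontal_section hX hpar hs
  refine ⟨_, h.self_of_nhds.2.2, c, ?_⟩
  have h1 : ∀ᶠ t in 𝓝 s, HasVel (fun t => C.form (c t) (z t)) t (0 : EG) := by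
    filter_upwards [h.eventually_nhds, σ.eventually_mem hs] with t ht htI
    exact hasVel_iff_hasDerivAt.2 (σ.hasDerivAt_form_zero htI (hgeo t htI) ht)
  filter_upwards [h, eventually_eq_of_hasVel_zero h1] with t ht ht'
  refine ⟨ht.1, ?_⟩
  rw [← ht', (C.form _).symm_apply_apply]
  exact ht.2.1

end CartanGeometry.WeylAlong

end Converse

/-! ### Integral curves in a Weyl structure, over the whole interval -/

section Gluing

variable {EB : Type*} [NormedAddCommGroup EB] [NormedSpace ℝ EB] [CompleteSpace EB]
  {B : Type*} [TopologicalSpace B] [T2Space B] [ChartedSpace EB B] [IsManifold 𝓘(ℝ, EB) ∞ B]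

open scoped Classical in
/-- Continuation of integral curves that stay in given subsets `K t`: it suffices that near each
time the integral curves through all points of the sets `K t` exist on a common interval. -/
lemma exists_integralCurve_of_local {V : ∀ x : B, TangentSpace 𝓘(ℝ, EB) x}
    (hV : ContMDiff 𝓘(ℝ, EB) 𝓘(ℝ, EB).tangent 1
      (fun x => (⟨x, V x⟩ : TangentBundle 𝓘(ℝ, EB) B)))
    {I : Set ℝ} (hI : IsPreconnected I) {K : ℝ → Set B} {s₀ : ℝ} (hs₀ : s₀ ∈ I) {e₀ : B}
    (he₀ : e₀ ∈ K s₀)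
    (hloc : ∀ t₁ ∈ I, ∃ ε > 0, ∀ t ∈ Ioo (t₁ - ε) (t₁ + ε), ∀ e ∈ K t, ∃ c : ℝ → B, c t = e ∧
      ∀ t' ∈ Ioo (t₁ - ε) (t₁ + ε), c t' ∈ K t' ∧ HasVel c t' (toModel (V (c t')))) :
    ∃ c : ℝ → B, c s₀ = e₀ ∧ ∀ t ∈ I, c t ∈ K t ∧ HasVel c t (toModel (V (c t))) := by
  have : IsManifold 𝓘(ℝ, EB) 1 B := IsManifold.of_le (n := ∞) (mod_cast le_top)
  let R : ℝ → ℝ → (ℝ → B) → Prop := fun a b c => s₀ ∈ Ioo a b ∧ c s₀ = e₀ ∧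
    ∀ t ∈ Ioo a b, c t ∈ K t ∧ HasVel c t (toModel (V (c t)))
  have hR : ∀ {a b c}, R a b c → IsMIntegralCurveOn c V (Ioo a b) := fun h =>
    (isMIntegralCurveOn_iff_hasVel isOpen_Ioo).2 fun t ht => (h.2.2 t ht).2
  let S : Set ℝ := {t | ∃ a b c, R a b c ∧ t ∈ Ioo a b}
  have hS : IsOpen S := isOpen_iff_mem_nhds.2 fun t ⟨a, b, c, h, ht⟩ =>
    Filter.mem_of_superset (Ioo_mem_nhds ht.1 ht.2) fun t' ht' => ⟨a, b, c, h, ht'⟩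
  have hs₀S : s₀ ∈ S := by
    obtain ⟨ε, hε, h⟩ := hloc s₀ hs₀
    have hm : s₀ ∈ Ioo (s₀ - ε) (s₀ + ε) := ⟨by linarith, by linarith⟩
    obtain ⟨c, hc, h⟩ := h s₀ hm e₀ he₀
    exact ⟨_, _, c, ⟨hm, hc, h⟩, hm⟩
  have hIS : I ⊆ S := by
    refine hI.subset_of_closure_inter_subset hS ⟨s₀, hs₀, hs₀S⟩ ?_
    rintro t₁ ⟨ht₁, ht₁I⟩
    obtain ⟨ε, hε, h⟩ := hloc t₁ ht₁I
    have hm : t₁ ∈ Ioo (t₁ - ε) (t₁ + ε) := ⟨by linarith, by linarith⟩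
    obtain ⟨t, htε, a, b, c, hc, ht⟩ := mem_closure_iff.1 ht₁ _ isOpen_Ioo hm
    obtain ⟨d, hd, hdK⟩ := h t htε (c t) (hc.2.2 t ht).1
    have hdV : IsMIntegralCurveOn d V (Ioo (t₁ - ε) (t₁ + ε)) :=
      (isMIntegralCurveOn_iff_hasVel isOpen_Ioo).2 fun t ht => (hdK t ht).2
    have hg := isMIntegralCurveOn_piecewise hV (hR hc) hdV ⟨ht, htε⟩ hd.symm
    have hu := Ioo_union_Ioo' (htε.1.trans ht.2) (ht.1.trans htε.2)
    rw [hu] at hg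
    have hsub : ∀ {x}, x ∈ Ioo a b ∪ Ioo (t₁ - ε) (t₁ + ε) →
        x ∈ Ioo (min a (t₁ - ε)) (max b (t₁ + ε)) := fun h => hu ▸ h
    refine ⟨_, _, _, ⟨hsub (Or.inl hc.1), ?_, fun t' ht' =>
      ⟨?_, (isMIntegralCurveOn_iff_hasVel isOpen_Ioo).1 hg t' ht'⟩⟩, hsub (Or.inr hm)⟩
    · rw [piecewise_eq_of_mem _ _ _ hc.1, hc.2.1]
    · by_cases h1 : t' ∈ Ioo a b
      · rw [piecewise_eq_of_mem _ _ _ h1]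
        exact (hc.2.2 t' h1).1
      · rw [piecewise_eq_of_notMem _ _ _ h1]
        rw [← hu] at ht'
        exact (hdK t' (ht'.resolve_left h1)).1
  have : Nonempty B := ⟨e₀⟩
  have hS' : ∀ t ∈ S, ∃ a b c, R a b c ∧ t ∈ Ioo a b := fun _ h => h
  choose! a b c hc hm using hS'
  -- by uniqueness, the chosen curves agree wherever two of them are defined
  have heq : ∀ t ∈ S, ∀ t' ∈ Ioo (a t) (b t), c t' t' = c t t' := by
    intro t ht t' hm'
    have ht' : t' ∈ S := ⟨_, _, _, hc t ht, hm'⟩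
    refine isMIntegralCurveOn_Ioo_eqOn_of_contMDiff_boundaryless
      (a := max (a t') (a t)) (b := min (b t') (b t)) (t₀ := s₀) ?_ hV
      ((hR (hc t' ht')).mono ?_) ((hR (hc t ht)).mono ?_)
      ((hc t' ht').2.1.trans (hc t ht).2.1.symm) ?_
    all_goals rw [← Ioo_inter_Ioo]
    exacts [⟨(hc t' ht').1, (hc t ht).1⟩, inter_subset_left, inter_subset_right,
      ⟨hm t' ht', hm'⟩]
  refine ⟨fun t => c t t, (hc s₀ hs₀S).2.1, fun t ht => ?_⟩
  obtain ⟨h1, h2⟩ := (hc t (hIS ht)).2.2 t (hm t (hIS ht))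
  exact ⟨h1, h2.congr (Filter.eventually_of_mem
    (Ioo_mem_nhds (hm t (hIS ht)).1 (hm t (hIS ht)).2) (heq t (hIS ht)))⟩

end Gluing

section Geodesics

variable {EG : Type*} [NormedAddCommGroup EG] [NormedSpace ℝ EG] [FiniteDimensional ℝ EG]
  [CompleteSpace EG]
  {G : Type*} [TopologicalSpace G] [ChartedSpace EG G] [Group G] [LieGroup 𝓘(ℝ, EG) ∞ G]
  {EP : Type*} [NormedAddCommGroup EP] [NormedSpace ℝ EP] [CompleteSpace EP]
  {P : Subgroup G} [ChartedSpace EP P] [LieGroup 𝓘(ℝ, EP) ∞ P]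
  {EB : Type*} [NormedAddCommGroup EB] [NormedSpace ℝ EB] [FiniteDimensional ℝ EB]
  {B : Type*} [TopologicalSpace B] [ChartedSpace EB B] [IsManifold 𝓘(ℝ, EB) ∞ B]
  {EM : Type*} [NormedAddCommGroup EM] [NormedSpace ℝ EM]
  {M : Type*} [TopologicalSpace M] [ChartedSpace EM M]
  {C : CartanGeometry EG EP EB B EM M P} {T : ParabolicType EG G EP P}
  {γ : ℝ → M} {I : Set ℝ}

namespace CartanGeometry

/-- Through every point of a Weyl structure that is parallel and for which `γ` is a geodesic, there
is an integral curve of a constant vector field `ω⁻¹(ξ)`, with `ξ ∈ 𝔤^{<0}`, that is a section of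
the reduction over the whole interval. -/
lemma WeylAlong.exists_global_integral_section [T2Space B] {EX : Type*}
    [NormedAddCommGroup EX] [NormedSpace ℝ EX]
    [ChartedSpace EX (G ⧸ T.Pm)] [IsManifold 𝓘(ℝ, EX) ∞ (G ⧸ T.Pm)] [T2Space G]
    (hX : ContMDiff (𝓘(ℝ, EG).prod 𝓘(ℝ, EX)) 𝓘(ℝ, EX) ∞
      (fun a : G × (G ⧸ T.Pm) => a.1 • a.2)) (σ : WeylAlong C T γ I)
    (hgeo : σ.IsGeodesic) (hpar : σ.IsParallel EX) (hI : IsPreconnected I) (hn : I.Nonempty) :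
    ∃ ξ ∈ T.negE, ∃ c : ℝ → B, ∀ t ∈ I, c t ∈ σ.carrier t ∧
      HasVel c t ((C.form (c t)).symm ξ) := by
  have : CompleteSpace EB := FiniteDimensional.complete ℝ EB
  obtain ⟨s₀, hs₀⟩ := hn
  obtain ⟨ξ₀, hξ₀, c₀, hc₀⟩ := σ.exists_integral_section hX hgeo hpar hs₀
  -- the points of the reduction whose integral curve of `ω⁻¹(ξ₀)` stays in the reduction
  let K : ℝ → Set B := fun t => {e | ∃ c : ℝ → B, c t = e ∧ ∀ᶠ t' in 𝓝 t, c t' ∈ σ.carrier t' ∧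
    HasVel c t' ((C.form (c t')).symm ξ₀)}
  have hV : ContMDiff 𝓘(ℝ, EB) 𝓘(ℝ, EB).tangent 1
      (fun e => (⟨e, C.constField (G := G) ξ₀ e⟩ : TangentBundle 𝓘(ℝ, EB) B)) :=
    (C.contMDiff_constField ξ₀).of_le (mod_cast le_top)
  obtain ⟨c, -, hc⟩ := exists_integralCurve_of_local hV hI (K := K) hs₀ (e₀ := c₀ s₀)
    ⟨c₀, rfl, hc₀⟩ (by
      intro t₁ ht₁
      obtain ⟨ξ₁, hξ₁, c₁, hc₁⟩ := σ.exists_integral_section hX hgeo hpar ht₁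
      obtain ⟨ε, hε, hb⟩ := Metric.eventually_nhds_iff_ball.1 (hc₁.and (σ.eventually_mem ht₁))
      rw [Real.ball_eq_Ioo] at hb
      refine ⟨ε, hε, ?_⟩
      rintro t ht e ⟨d, rfl, hd⟩
      have hev : ∀ t ∈ Ioo (t₁ - ε) (t₁ + ε), ∀ᶠ t' in 𝓝 t, t' ∈ Ioo (t₁ - ε) (t₁ + ε) :=
        fun t ht => Ioo_mem_nhds ht.1 ht.2
      obtain ⟨⟨h1, h1v⟩, htI⟩ := hb t ht
      obtain ⟨h2, h2v⟩ := hd.self_of_nhds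
      obtain ⟨p, hp, hdp⟩ := (σ.orbit t htI _ h1 _).1 h2
      have hv := C.hasVel_act_const h1v p
      have hmem : ∀ t' ∈ Ioo (t₁ - ε) (t₁ + ε), C.act (c₁ t') p ∈ σ.carrier t' := fun t' ht' =>
        (σ.orbit t' (hb t' ht').2 _ (hb t' ht').1.1 _).2 ⟨p, hp, rfl⟩
      -- the two integral curves have the same projection, so their generators agree
      have hξ : adE (p : G)⁻¹ ξ₁ = ξ₀ := by
        have h3 := C.form_sub_form_mem T hv h2v
          (σ.eventually_proj htI ((hev t ht).mono hmem))
          (σ.eventually_proj htI (hd.mono fun t h => h.1)) hdp.symm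
        rw [(C.form _).apply_symm_apply, (C.form _).apply_symm_apply] at h3
        exact T.eq_of_sub_mem (T.adE_mem_negE (T.P0.inv_mem hp) hξ₁) hξ₀ h3
      have hall : ∀ t' ∈ Ioo (t₁ - ε) (t₁ + ε), C.act (c₁ t') p ∈ σ.carrier t' ∧
          HasVel (fun t => C.act (c₁ t) p) t' ((C.form (C.act (c₁ t') p)).symm ξ₀) := by
        intro t' ht'
        have h3 := C.hasVel_act_const (hb t' ht').1.2 p
        rw [hξ] at h3
        exact ⟨hmem t' ht', h3⟩
      exact ⟨fun t => C.act (c₁ t) p, hdp.symm, fun t' ht' =>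
        ⟨⟨_, rfl, (hev t' ht').mono hall⟩, (hall t' ht').2⟩⟩)
  refine ⟨ξ₀, hξ₀, c, fun t ht => ⟨?_, (hc t ht).2⟩⟩
  obtain ⟨d, hd, h⟩ := (hc t ht).1
  exact hd ▸ h.self_of_nhds.1

/-- A nonconstant curve with a parallel Weyl structure for which it is a geodesic is a parabolic
geodesic. -/
lemma WeylAlong.isParabolicGeodesic [T2Space B] [IsManifold 𝓘(ℝ, EM) ∞ M] {EX : Type*}
    [NormedAddCommGroup EX] [NormedSpace ℝ EX]
    [ChartedSpace EX (G ⧸ T.Pm)] [IsManifold 𝓘(ℝ, EX) ∞ (G ⧸ T.Pm)] [T2Space G]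
    (hX : ContMDiff (𝓘(ℝ, EG).prod 𝓘(ℝ, EX)) 𝓘(ℝ, EX) ∞
      (fun a : G × (G ⧸ T.Pm) => a.1 • a.2)) (σ : WeylAlong C T γ I)
    (hgeo : σ.IsGeodesic) (hpar : σ.IsParallel EX) (hIo : IsOpen I) (hI : IsPreconnected I)
    (hne : ∃ s ∈ I, ∃ t ∈ I, γ s ≠ γ t) : C.IsParabolicGeodesic T γ I := by
  have : IsManifold 𝓘(ℝ, EM) 1 M := IsManifold.of_le (n := ∞) (mod_cast le_top)
  obtain ⟨s, hs, t, ht, hst⟩ := hne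
  obtain ⟨ξ, hξ, c, hc⟩ := σ.exists_global_integral_section hX hgeo hpar hI ⟨s, hs⟩
  refine (C.isParabolicGeodesic_iff T hIo).2 ⟨ξ, hξ, ?_, c, fun t ht => (hc t ht).2,
    fun t ht => σ.proj_eq t ht _ (hc t ht).1⟩
  rintro rfl
  refine hst (eq_of_hasVel_zero (E := EM) hIo hI (fun t ht => ?_) hs ht)
  have h := C.hasVel_proj (hc t ht).2 (σ.eventually_proj ht
    (Filter.eventually_of_mem (hIo.mem_nhds ht) fun t ht => (hc t ht).1))
  simpa using h

/-- A parabolic geodesic is not constant: its velocity is represented by a nonzero element of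
`𝔤^{<0}`. -/
lemma IsParabolicGeodesic.exists_ne (hIo : IsOpen I) (hn : I.Nonempty)
    (h : C.IsParabolicGeodesic T γ I) : ∃ s ∈ I, ∃ t ∈ I, γ s ≠ γ t := by
  obtain ⟨ξ, hξ, h0, c, hc, hγ⟩ := (C.isParabolicGeodesic_iff T hIo).1 h
  obtain ⟨s, hs⟩ := hn
  by_contra! hcon
  have h1 := C.hasVel_proj (hc s hs) (Filter.eventually_of_mem (hIo.mem_nhds hs) hγ)
  have h2 : HasVel γ s (0 : EM) := (hasVel_const (γ s) s).congr
    (Filter.eventually_of_mem (hIo.mem_nhds hs) fun t ht => hcon t ht s hs)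
  have h3 := h1.unique h2
  rw [(C.form _).apply_symm_apply, C.anchor_eq_zero_iff T] at h3
  exact h0 (T.eq_zero_of_mem hξ h3)

/-- The integral curve over a parabolic geodesic determines a parallel Weyl structure for which the
curve is a geodesic. -/
lemma IsParabolicGeodesic.exists_weylAlong {EX : Type*}
    [NormedAddCommGroup EX] [NormedSpace ℝ EX]
    [ChartedSpace EX (G ⧸ T.Pm)] [IsManifold 𝓘(ℝ, EX) ∞ (G ⧸ T.Pm)] [T2Space G]
    (hX : ContMDiff (𝓘(ℝ, EG).prod 𝓘(ℝ, EX)) 𝓘(ℝ, EX) ∞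
      (fun a : G × (G ⧸ T.Pm) => a.1 • a.2)) (hIo : IsOpen I)
    (h : C.IsParabolicGeodesic T γ I) :
    ∃ σ : WeylAlong C T γ I, σ.IsGeodesic ∧ σ.IsParallel EX := by
  have : CompleteSpace EB := FiniteDimensional.complete ℝ EB
  obtain ⟨ξ, hξ, -, c, hc, hγ⟩ := (C.isParabolicGeodesic_iff T hIo).1 h
  have hs : ContMDiffOn 𝓘(ℝ, ℝ) 𝓘(ℝ, EB) ∞ c I :=
    contMDiffOn_of_hasVel (C.contMDiff_constField ξ) hIo hc
  exact ⟨C.weylOfLift hIo hs hγ, C.isGeodesic_weylOfLift hIo hs hγ hξ hc,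
    C.isParallel_weylOfLift hIo hs hγ hξ hc hX⟩

end CartanGeometry

end Geodesics

end ParabolicGeometry

end

theorem mainTheorem1
    {EG : Type*} [NormedAddCommGroup EG] [NormedSpace ℝ EG] [FiniteDimensional ℝ EG] [CompleteSpace EG]
    {G : Type*} [TopologicalSpace G] [T2Space G] [SecondCountableTopology G]
    [ChartedSpace EG G] [Group G] [LieGroup 𝓘(ℝ, EG) ∞ G]
    {EP : Type*} [NormedAddCommGroup EP] [NormedSpace ℝ EP] [FiniteDimensional ℝ EP]
    {P : Subgroup G} [ChartedSpace EP P] [LieGroup 𝓘(ℝ, EP) ∞ P]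
    (T : ParabolicGeometry.ParabolicType EG G EP P)
    -- the smooth structure of the homogeneous space `G / P⁻`, for which `G` acts smoothly
    {EX : Type*} [NormedAddCommGroup EX] [NormedSpace ℝ EX] [FiniteDimensional ℝ EX]
    [ChartedSpace EX (G ⧸ T.Pm)] [IsManifold 𝓘(ℝ, EX) ∞ (G ⧸ T.Pm)]
    (hX : ContMDiff (𝓘(ℝ, EG).prod 𝓘(ℝ, EX)) 𝓘(ℝ, EX) ∞
      (fun a : G × (G ⧸ T.Pm) => a.1 • a.2))
    {EM : Type*} [NormedAddCommGroup EM] [NormedSpace ℝ EM] [FiniteDimensional ℝ EM]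
    {M : Type*} [TopologicalSpace M] [T2Space M] [SecondCountableTopology M] [ConnectedSpace M]
    [ChartedSpace EM M] [IsManifold 𝓘(ℝ, EM) ∞ M]
    {EB : Type*} [NormedAddCommGroup EB] [NormedSpace ℝ EB] [FiniteDimensional ℝ EB]
    {B : Type*} [TopologicalSpace B] [T2Space B]
    [ChartedSpace EB B] [IsManifold 𝓘(ℝ, EB) ∞ B]
    (C : ParabolicGeometry.CartanGeometry EG EP EB B EM M P)
    (I : Set ℝ) (hIo : IsOpen I) (hIc : I.OrdConnected) (hIn : I.Nonempty)
    (γ : ℝ → M) (hγ : ContMDiffOn 𝓘(ℝ, ℝ) 𝓘(ℝ, EM) ∞ γ I) :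
    C.IsParabolicGeodesic T γ I ↔
      (∃ s ∈ I, ∃ t ∈ I, γ s ≠ γ t) ∧
      ∃ σ : ParabolicGeometry.CartanGeometry.WeylAlong C T γ I,
        σ.IsGeodesic ∧ σ.IsParallel EX := by
  have : CompleteSpace EP := FiniteDimensional.complete ℝ EP
  exact ⟨fun h => ⟨h.exists_ne hIo hIn, h.exists_weylAlong hX hIo⟩,
    fun ⟨hne, σ, h1, h2⟩ => σ.isParabolicGeodesic hX h1 h2 hIo hIc.isPreconnected hne⟩
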